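/- Let $n,k$ be integers with $2\le k\le n-1$. For $c\in\{-1,0,1\}$ let $X$ be the $n$-dimensional simply connected model space of constant curvature $c$, realised in $\mathbb R^{n+1}$: $X=\mathbb R^n\simeq\{x: x_{n+1}=1\}$ for $c=0$, $X=\mathbb H^n=\{x: x_{n+1}^2-x_1^2-\dots-x_n^2=1,\ x_{n+1}>0\}$ with the metric induced by the Lorentzian form $x_1y_1+\dots+x_ny_n-x_{n+1}y_{n+1}$ for $c=-1$, and $X=\mathbb S^n$, the unit sphere, for $c=1$. Let $o=e_{n+1}\in X$, let $d$ be the geodesic distance of $X$, and let $s_c(t)=t,\ \sinh t,\ \sin t$ for $c=0,-1,1$ respectively. Let $\Xi_k$ be the set of (complete) $k$-dimensional totally geodesic submanifolds of $X$, that is, of the nonempty intersections of $X$ with $(k+1)$-dimensional linear subspaces of $\mathbb R^{n+1}$; for $\xi\in\Xi_k$ put $d(o,\xi)=\inf_{x\in\xi}d(o,x)$ and $R_kf(\xi)=\int_\xi f\,d_\xi x$, where $d_\xi x$ is the Riemannian measure of $\xi$ for the induced metric. A function $f:X\to\mathbb C$ is radial if $f(x)=\tilde f\big(s_c(d(o,x)/2)\big)$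 for some function $\tilde f$, i.e. if $f(x)$ depends only on $d(o,x)$. Let $\mu$ be the Riemannian measure of $X$, and for measurable $f$ let $$\|f\|_{L^{p,1}(X)}=\int_0^\infty \mu\{x\in X:|f(x)|>t\}^{1/p}\,dt$$ be the Lorentz norm. Put $p=\frac nk$ if $X=\mathbb R^n$ or $X=\mathbb S^n$, and $p=\frac{n-1}{k-1}$ if $X=\mathbb H^n$. Then there is a constant $K$, depending only on $n$ and $k$, such that for each of the three spaces $X$ and every radial $f\in L^{p,1}(X)$, the function $f$ is integrable on every $\xi\in\Xi_k$ and $$\sup_{\xi\in\Xi_k}\big|s_c'(d(o,\xi))\,R_kf(\xi)\big|\le K\,\|f\|_{L^{p,1}(X)}.$$ In particular $\|s_c'(d(o,\cdot))R_kf\|_{L^\infty(\Xi_k)}\le K\|f\|_{L^{p,1}(X)}$. -/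

import Mathlib

open MeasureTheory Set
open scoped NNReal ENNReal ContDiff

noncomputable section

namespace ConstantCurvature

/-- The curvature function: the solution of `u'' + c u = 0`, `u 0 = 0`, `u' 0 = 1`,
for the curvature `c ∈ {-1, 0, 1}` (the type `SignType`). -/
def s : SignType → ℝ → ℝ
  | .zero, t => t
  | .neg, t => Real.sinh t
  | .pos, t => Real.sin t

/-- The ambient space `ℝⁿ⁺¹` in which the three model spaces are realised. -/
abbrev Ambient (n : ℕ) : Type := EuclideanSpace ℝ (Fin (n + 1))

/-- The ambient bilinear form `∑_{i ≤ n} x_i y_i + c x_{n+1} y_{n+1}`. Its restriction to the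
tangent spaces of the model space of curvature `c` is the Riemannian metric: the Euclidean form for
`c = 1`, the Lorentzian form for `c = -1`, and for `c = 0` (where tangent vectors have last
coordinate `0`) the Euclidean form of `ℝⁿ`. -/
def form (c : SignType) {n : ℕ} (x y : Ambient n) : ℝ :=
  (∑ i : Fin n, x i.castSucc * y i.castSucc) + (c : ℝ) * (x (Fin.last n) * y (Fin.last n))

/-- The model space of dimension `n` and curvature `c`, as a subset of `ℝⁿ⁺¹`: the unit sphere
(`c = 1`), the affine hyperplane `x_{n+1} = 1` (`c = 0`), the upper sheet
`x_{n+1}² - ∑_{i ≤ n} x_i² = 1`, `x_{n+1} > 0` of the hyperboloid (`c = -1`). -/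
def modelSet : SignType → (n : ℕ) → Set (Ambient n)
  | .zero, n => {x | x (Fin.last n) = 1}
  | .neg, n => {x | x (Fin.last n) ^ 2 - ∑ i : Fin n, x i.castSucc ^ 2 = 1 ∧ 0 < x (Fin.last n)}
  | .pos, n => {x | (∑ i : Fin n, x i.castSucc ^ 2) + x (Fin.last n) ^ 2 = 1}

/-- The simply connected model space `X`: `ℝⁿ`, `ℍⁿ` or `𝕊ⁿ`. -/
abbrev Model (c : SignType) (n : ℕ) : Type := modelSet c n

/-- The common origin `o = e_{n+1}` of the three model spaces. -/
def origin (c : SignType) (n : ℕ) : Model c n :=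
  ⟨EuclideanSpace.single (Fin.last n) 1, by
    cases c <;> simp [modelSet, Fin.castSucc_ne_last]⟩

/-- The geodesic distance of the model space: `|x - y|` on `ℝⁿ`, `cosh d = -⟨x, y⟩` for the
Lorentzian form on `ℍⁿ`, `cos d = ⟨x, y⟩` on `𝕊ⁿ`. -/
def geodDist : (c : SignType) → {n : ℕ} → Model c n → Model c n → ℝ
  | .zero, _, x, y => dist x.1 y.1
  | .neg, _, x, y => Real.arcosh (-form (-1) x.1 y.1)
  | .pos, _, x, y => Real.arccos (form 1 x.1 y.1)

/-- The distance `d(o, ξ) = inf_{x ∈ ξ} d(o, x)` of the origin to a subset `ξ` of the model space. -/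
def originDist (c : SignType) {n : ℕ} (ξ : Set (Model c n)) : ℝ :=
  sInf (geodDist c (origin c n) '' ξ)

/-- `Ξ_k`: the `k`-dimensional (complete) totally geodesic submanifolds of the model space, i.e. its
nonempty intersections with the `(k+1)`-dimensional linear subspaces of `ℝⁿ⁺¹`. For the three model
spaces these are the affine `k`-planes, the `k`-dimensional hyperbolic subspaces and the great
`k`-spheres. -/
def totallyGeodesic (c : SignType) (n k : ℕ) : Set (Set (Model c n)) :=
  {ξ | ξ.Nonempty ∧ ∃ V : Submodule ℝ (Ambient n),
    Module.finrank ℝ V = k + 1 ∧ ξ = {x : Model c n | (x : Ambient n) ∈ V}}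

/-- The Gram matrix `g(∂_i φ, ∂_j φ)` at `y` of a map `φ` from `ℝᵏ` to the model space. -/
def gram (c : SignType) {n k : ℕ} (φ : EuclideanSpace ℝ (Fin k) → Model c n)
    (y : EuclideanSpace ℝ (Fin k)) : Matrix (Fin k) (Fin k) ℝ :=
  Matrix.of fun i j =>
    form c (fderiv ℝ (fun z => (φ z : Ambient n)) y (EuclideanSpace.single i 1))
      (fderiv ℝ (fun z => (φ z : Ambient n)) y (EuclideanSpace.single j 1))

/-- `φ` restricted to the open set `U ⊆ ℝᵏ` is a local parametrisation of the subset `S` of the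
model space: a smooth injective immersion of `U` with values in `S`. -/
structure IsLocalParam (c : SignType) {n k : ℕ} (S : Set (Model c n))
    (U : Set (EuclideanSpace ℝ (Fin k))) (φ : EuclideanSpace ℝ (Fin k) → Model c n) : Prop where
  isOpen : IsOpen U
  smooth : ContDiffOn ℝ ∞ (fun z => (φ z : Ambient n)) U
  injOn : InjOn φ U
  immersion : ∀ y ∈ U, Function.Injective (fderiv ℝ (fun z => (φ z : Ambient n)) y)
  mapsTo : MapsTo φ U S

/-- The Riemannian measure `√(det g) dy` of the parametrised piece `φ(U)`, as a measure on the
model space. -/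
def paramMeasure (c : SignType) {n k : ℕ} (U : Set (EuclideanSpace ℝ (Fin k)))
    (φ : EuclideanSpace ℝ (Fin k) → Model c n) : Measure (Model c n) :=
  Measure.map φ ((volume.restrict U).withDensity fun y => ENNReal.ofReal √(gram c φ y).det)

/-- The Riemannian measure of a `k`-dimensional embedded submanifold `S` of the model space (with
the induced metric), as a measure on the model space concentrated on `S`. The measures `√(det g) dy`
of two parametrised pieces agree on the overlap, so the measure that they define together is
the least measure that dominates all of them. -/
def riemannianMeasure (c : SignType) {n : ℕ} (k : ℕ) (S : Set (Model c n)) :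
    Measure (Model c n) :=
  sSup {ν | ∃ (U : Set (EuclideanSpace ℝ (Fin k))) (φ : EuclideanSpace ℝ (Fin k) → Model c n),
    IsLocalParam c S U φ ∧ ν = paramMeasure c U φ}

/-- The Riemannian measure of the whole model space `X`. -/
def vol (c : SignType) (n : ℕ) : Measure (Model c n) := riemannianMeasure c n univ

/-- The totally geodesic `k`-plane transform `R_k f(ξ) = ∫_ξ f(x) d_ξ x`. -/
def kPlaneTransform (c : SignType) {n : ℕ} (k : ℕ) (f : Model c n → ℂ) (ξ : Set (Model c n)) : ℂ :=
  ∫ x, f x ∂(riemannianMeasure c k ξ)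

/-- Radial functions: `f(x)` is a function of `s_c(d(o, x) / 2)`, i.e. of `d(o, x)`. -/
def IsRadial (c : SignType) {n : ℕ} (f : Model c n → ℂ) : Prop :=
  ∃ F : ℝ → ℂ, ∀ x, f x = F (s c (geodDist c (origin c n) x / 2))

/-- The Lorentz norm of `L^{p,1}(μ)`, that is
`∫_0^∞ μ{|f| > t}^{1/p} dt = (1/p) ∫_0^∞ t^{1/p} f^*(t) dt/t`, where `f^*` is the decreasing
rearrangement. It is normalised so that the indicator function of `E` has norm `μ(E)^{1/p}`. -/
def lorentzNorm {X : Type*} [MeasurableSpace X] (p : ℝ) (μ : Measure X) (f : X → ℂ) : ℝ≥0∞ :=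
  ∫⁻ t in Ioi (0 : ℝ), μ {x | t < ‖f x‖} ^ (1 / p)

/-- `f` belongs to the Lorentz space `L^{p,1}(μ)`. -/
def MemLorentz {X : Type*} [MeasurableSpace X] (p : ℝ) (μ : Measure X) (f : X → ℂ) : Prop :=
  AEStronglyMeasurable f μ ∧ lorentzNorm p μ f < ⊤

/-- The end-point exponent: `n / k` for `ℝⁿ` and `𝕊ⁿ`, `(n - 1) / (k - 1)` for `ℍⁿ`. -/
def endpoint : SignType → ℕ → ℕ → ℝ
  | .zero, n, k => (n : ℝ) / k
  | .neg, n, k => ((n : ℝ) - 1) / ((k : ℝ) - 1)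
  | .pos, n, k => (n : ℝ) / k

end ConstantCurvature

end

open ConstantCurvature

/-! Let ξ = X ∩ V not lie in the equator x_{n+1} = 0. There are linear coordinates (y, ζ) on V in
which X is the quadric c|y|² + ζ² = 1, the last ambient coordinate is qζ and the squared distance to
the axis ℝo is |y|² + a²ζ², with q > 0 and q² + ca² = 1 (`exists_axialFrame`). The Riemannian
measure of ξ is carried by the graphs ζ = ±√(1 - c|y|²) and has density 1/|ζ| in y. On one sheet or
hemisphere a radial function depends only on the distance r to the axis, so everything reduces to
the measures `radialMeasure c k` with density r^(k-1)/√(1 - cr²) on the line.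

Two inequalities carry the proof. For a plane at positive distance from o, the distance to the axis
is τ(r) = √(a² + q²r²) ≥ r, and q times the image of `radialMeasure c k` under τ is at most
`radialMeasure c k` (`smul_map_radius_le`). Since |s_c'(d(o,ξ))| ≤ q (`abs_deriv_s_originDist_le`),
the weight reduces the estimate to planes through o.

For those, `radialMeasure_le_rpow` is a restricted inequality μ_k(A) ≤ 3 μ_n(A)^(1/p). It follows by
cutting A at a radius ρ: below ρ, μ_k has mass at most 2ρ^(k-l), where l = 1 for ℍⁿ and l = 0
otherwise; above ρ, the density of μ_k is at most ρ^(k-n) times that of μ_n. The choice ρ^(n-l) =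
μ_n(A) balances the two terms. Applied to the level sets of |f| and integrated over the levels, it
gives the L^{p,1} bound.

On great spheres inside the equator the weight vanishes, and f is constant there, hence integrable.
-/

open scoped RealInnerProductSpace

noncomputable section

namespace ConstantCurvature

/-! ### Differential calculus on the quadric c|x|² + ζ² = 1. -/

/-- The Gram determinant of a graph over `ℝᵏ` in the quadric `c |x|² + ζ² = 1`. -/
theorem det_gram_of_quadric {k : ℕ}
    (D : EuclideanSpace ℝ (Fin k) →L[ℝ] EuclideanSpace ℝ (Fin k))
    (η : EuclideanSpace ℝ (Fin k) →L[ℝ] ℝ) (x : EuclideanSpace ℝ (Fin k)) (ζ c : ℝ)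
    (hc : c ^ 3 = c) (hx : c * ‖x‖ ^ 2 + ζ ^ 2 = 1) (hζ : ζ ≠ 0)
    (hd : ∀ w, c * ⟪x, D w⟫ + ζ * η w = 0) :
    (Matrix.of fun i j : Fin k =>
      ⟪D (EuclideanSpace.single i 1), D (EuclideanSpace.single j 1)⟫ +
        c * (η (EuclideanSpace.single i 1) * η (EuclideanSpace.single j 1))).det
      = (D.det / ζ) ^ 2 := by
  set b := (EuclideanSpace.basisFun (Fin k) ℝ).toBasis
  set M := LinearMap.toMatrix b b (D : _ →ₗ[ℝ] _) with hM
  have hMij : ∀ i j, M i j = D (EuclideanSpace.single j 1) i := by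
    intro i j
    simp [hM, b, LinearMap.toMatrix_apply]
  have hdet : D.det = M.det := by
    rw [hM, LinearMap.det_toMatrix]
  set u : Fin k → ℝ := fun i => ⟪x, D (EuclideanSpace.single i 1)⟫ with hu
  have hη : ∀ i : Fin k, η (EuclideanSpace.single i 1) = -c * u i / ζ := by
    intro i
    have := hd (EuclideanSpace.single i 1)
    field_simp
    simp only [hu]
    linarith
  have hui : ∀ i, u i = ∑ l, x l * M l i := by
    intro i
    simp only [hu, PiLp.inner_apply, hMij]
    exact Finset.sum_congr rfl fun _ _ => by simp [mul_comm]
  -- The tangency relation eliminates dζ, so the Gram matrix is Mᵀ(1 + (c/ζ²)xxᵀ)M, where c³ = c is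
  -- used. The rank-one determinant formula gives 1 + c|x|²/ζ² = 1/ζ² for the middle factor.
  have key : (Matrix.of fun i j : Fin k =>
      ⟪D (EuclideanSpace.single i 1), D (EuclideanSpace.single j 1)⟫ +
        c * (η (EuclideanSpace.single i 1) * η (EuclideanSpace.single j 1)))
      = M.transpose * ((1 + Matrix.replicateCol Unit (fun l => c / ζ ^ 2 * x l) *
          Matrix.replicateRow Unit (fun l => x l)) * M) := by
    rw [Matrix.add_mul, Matrix.one_mul, Matrix.mul_add]
    ext i j
    have h1 : (M.transpose * M) i j =
        ⟪D (EuclideanSpace.single i 1), D (EuclideanSpace.single j 1)⟫ := by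
      simp only [Matrix.mul_apply, Matrix.transpose_apply, PiLp.inner_apply, hMij]
      exact Finset.sum_congr rfl fun _ _ => by simp [mul_comm]
    have h2 : (M.transpose * (Matrix.replicateCol Unit (fun l => c / ζ ^ 2 * x l) *
          Matrix.replicateRow Unit (fun l => x l) * M)) i j = c / ζ ^ 2 * (u i * u j) := by
      rw [Matrix.mul_assoc, ← Matrix.mul_assoc]
      simp only [Matrix.mul_apply, Matrix.transpose_apply, Matrix.replicateCol_apply,
        Matrix.replicateRow_apply, Finset.univ_unique, Finset.sum_singleton, hui]
      rw [← mul_assoc, Finset.mul_sum (a := c / ζ ^ 2)]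
      congr 1
      exact Finset.sum_congr rfl fun _ _ => by ring
    rw [Matrix.add_apply, h1, h2, Matrix.of_apply, hη, hη]
    congr 1
    field_simp
    linear_combination (u i * u j) * hc
  rw [key, Matrix.det_mul, Matrix.det_mul, Matrix.det_transpose,
    Matrix.det_one_add_replicateCol_mul_replicateRow, hdet]
  have h3 : (fun l => x l) ⬝ᵥ (fun l => c / ζ ^ 2 * x l) = c / ζ ^ 2 * ‖x‖ ^ 2 := by
    rw [EuclideanSpace.real_norm_sq_eq, dotProduct, Finset.mul_sum]
    exact Finset.sum_congr rfl fun _ _ => by ring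
  rw [h3]
  field_simp
  rw [show ζ ^ 2 + c * ‖x‖ ^ 2 = 1 by linarith]
  ring

/-- This is half the derivative of the constant function c|h|² + ζ²: tangent vectors are orthogonal
to the position vector. -/
theorem inner_fderiv_of_quadric {E G : Type*} [NormedAddCommGroup E] [NormedSpace ℝ E]
    [NormedAddCommGroup G] [InnerProductSpace ℝ G] {U : Set E} (hU : IsOpen U) {y : E} (hy : y ∈ U)
    {h : E → G} {ζ : E → ℝ} {h' : E →L[ℝ] G} {ζ' : E →L[ℝ] ℝ} (hd : HasFDerivAt h h' y)
    (hdζ : HasFDerivAt ζ ζ' y) {c : ℝ} (hq : ∀ z ∈ U, c * ‖h z‖ ^ 2 + ζ z ^ 2 = 1) (w : E) :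
    c * ⟪h y, h' w⟫ + ζ y * ζ' w = 0 := by
  have h1 : HasFDerivAt (fun y => c * ‖h y‖ ^ 2 + ζ y ^ 2) _ y :=
    (hd.norm_sq.const_mul c).add (hdζ.pow 2)
  have h2 : HasFDerivAt (fun y => c * ‖h y‖ ^ 2 + ζ y ^ 2) (0 : E →L[ℝ] ℝ) y := by
    refine (hasFDerivAt_const (1 : ℝ) y).congr_of_eventuallyEq ?_
    filter_upwards [hU.mem_nhds hy] with z hz using hq z hz
  have h3 := congrArg (fun L : E →L[ℝ] ℝ => L w) (h1.unique h2)
  simp at h3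
  linarith

/-- The equator of a sphere is negligible in every parametrisation. -/
theorem volume_equator_eq_zero {k : ℕ} {U : Set (EuclideanSpace ℝ (Fin k))} (hU : IsOpen U)
    {h : EuclideanSpace ℝ (Fin k) → EuclideanSpace ℝ (Fin k)}
    {ζ : EuclideanSpace ℝ (Fin k) → ℝ}
    (hh : DifferentiableOn ℝ h U) (hζ : DifferentiableOn ℝ ζ U)
    (hq : ∀ y ∈ U, ‖h y‖ ^ 2 + ζ y ^ 2 = 1)
    (hinj : InjOn (fun y => (h y, ζ y)) U)
    (himm : ∀ y ∈ U, ∀ w, fderiv ℝ h y w = 0 → fderiv ℝ ζ y w = 0 → w = 0) :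
    volume {y ∈ U | ζ y = 0} = 0 := by
  -- On the equator |h| = 1, so some coordinate of h is nonzero. Fixing that coordinate and its sign
  -- lets it be recovered from the others.
  have hsub : {y ∈ U | ζ y = 0} ⊆
      ⋃ (i : Fin k) (b : Bool), {y ∈ U | ζ y = 0 ∧ 0 < (if b then h y i else - h y i)} := by
    rintro y ⟨hyU, hy⟩
    have h1 := hq y hyU
    rw [hy, EuclideanSpace.real_norm_sq_eq] at h1
    obtain ⟨i, -, hi⟩ : ∃ i ∈ Finset.univ, h y i ^ 2 ≠ 0 := by
      apply Finset.exists_ne_zero_of_sum_ne_zero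
      intro h0
      rw [h0] at h1
      norm_num at h1
    have hi' : h y i ≠ 0 := fun h0 => hi (by rw [h0]; norm_num)
    simp only [mem_iUnion]
    rcases lt_or_gt_of_ne hi' with hlt | hgt
    · exact ⟨i, false, hyU, hy, by simpa using hlt⟩
    · exact ⟨i, true, hyU, hy, by simpa using hgt⟩
  refine measure_mono_null hsub ?_
  refine measure_iUnion_null fun i => measure_iUnion_null fun b => ?_
  set N := {y ∈ U | ζ y = 0 ∧ 0 < (if b then h y i else - h y i)} with hN
  have hNU : N ⊆ U := fun y hy => hy.1
  have hci : ContinuousOn (fun y => h y i) U :=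
    (EuclideanSpace.proj (𝕜 := ℝ) i).continuous.comp_continuousOn hh.continuousOn
  have hNm : MeasurableSet N := by
    have e : N = (U ∩ ζ ⁻¹' {0}) ∩
        (U ∩ (fun y => if b then h y i else - h y i) ⁻¹' (Ioi 0)) := by
      ext y
      simp only [hN, mem_ofPred_eq, mem_inter_iff, mem_preimage, mem_singleton_iff, mem_Ioi]
      tauto
    rw [e]
    refine MeasurableSet.inter ?_ ?_
    · obtain ⟨F, hF, hF'⟩ := (continuousOn_iff_isClosed.1 hζ.continuousOn) {0} isClosed_singleton
      rw [inter_comm, hF']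
      exact hF.measurableSet.inter hU.measurableSet
    · refine (ContinuousOn.isOpen_inter_preimage ?_ hU isOpen_Ioi).measurableSet
      cases b
      · simp only [Bool.false_eq_true, if_false]
        exact hci.neg
      · simpa using hci
  -- replace the `i`-th coordinate by `ζ`
  set g : EuclideanSpace ℝ (Fin k) → EuclideanSpace ℝ (Fin k) :=
    fun y => h y + (ζ y - h y i) • EuclideanSpace.single i (1 : ℝ) with hg
  set g' : EuclideanSpace ℝ (Fin k) → EuclideanSpace ℝ (Fin k) →L[ℝ] EuclideanSpace ℝ (Fin k) :=
    fun y => fderiv ℝ h y + (fderiv ℝ ζ y - (EuclideanSpace.proj (𝕜 := ℝ) i).comp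
      (fderiv ℝ h y)).smulRight (EuclideanSpace.single i (1 : ℝ)) with hg'
  have hd : ∀ y ∈ U, HasFDerivAt h (fderiv ℝ h y) y := fun y hy =>
    ((hh y hy).differentiableAt (hU.mem_nhds hy)).hasFDerivAt
  have hdζ : ∀ y ∈ U, HasFDerivAt ζ (fderiv ℝ ζ y) y := fun y hy =>
    ((hζ y hy).differentiableAt (hU.mem_nhds hy)).hasFDerivAt
  have hgd : ∀ y ∈ U, HasFDerivAt g (g' y) y := by
    intro y hy
    refine (hd y hy).add ?_
    have := ((hdζ y hy).sub ((EuclideanSpace.proj (𝕜 := ℝ) i).hasFDerivAt.comp y (hd y hy)))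
    exact this.smul_const _
  have hgi : ∀ y, g y i = ζ y := by intro y; simp [hg]
  have hgj : ∀ y j, j ≠ i → g y j = h y j := by intro y j hj; simp [hg, hj]
  have hconstr : ∀ y ∈ U, ∀ w, 1 * ⟪h y, fderiv ℝ h y w⟫ + ζ y * fderiv ℝ ζ y w = 0 :=
    fun y hy w => inner_fderiv_of_quadric hU hy (hd y hy) (hdζ y hy)
      (fun z hz => by rw [one_mul]; exact hq z hz) w
  have hginj : InjOn g N := by
    intro y hy z hz hyz
    have hj : ∀ j, j ≠ i → h y j = h z j := fun j hji => by
      rw [← hgj y j hji, ← hgj z j hji, hyz]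
    have hi : h y i = h z i := by
      have h1 := hq y hy.1
      have h2 := hq z hz.1
      rw [hy.2.1, EuclideanSpace.real_norm_sq_eq,
        ← Finset.add_sum_erase _ _ (Finset.mem_univ i)] at h1
      rw [hz.2.1, EuclideanSpace.real_norm_sq_eq,
        ← Finset.add_sum_erase _ _ (Finset.mem_univ i)] at h2
      rw [Finset.sum_congr rfl (fun j hji => by rw [hj j (Finset.ne_of_mem_erase hji)])] at h1
      have h3 : h y i ^ 2 = h z i ^ 2 := by linarith
      have hyp := hy.2.2
      have hzp := hz.2.2
      rcases sq_eq_sq_iff_eq_or_eq_neg.1 h3 with h4 | h4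
      · exact h4
      · cases b <;> simp at hyp hzp <;> linarith
    refine hinj hy.1 hz.1 ?_
    refine Prod.ext ?_ ?_
    · ext j
      by_cases hji : j = i
      · rw [hji]; exact hi
      · exact hj j hji
    · show ζ y = ζ z
      rw [hy.2.1, hz.2.1]
  -- If `g' y` kills w, then dζ and all components of dh except the i-th vanish on w. Orthogonality
  -- to h with h_i ≠ 0 kills the i-th one too, which contradicts immersivity unless w = 0.
  have hdet : ∀ y ∈ N, (g' y).det ≠ 0 := by
    intro y hy h0
    have hni : ¬ Function.Injective (g' y) := by
      intro hinj'
      have : LinearMap.det (g' y).toLinearMap = 0 := h0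
      have hk := LinearMap.bot_lt_ker_of_det_eq_zero this
      rw [LinearMap.ker_eq_bot.2 hinj'] at hk
      exact lt_irrefl _ hk
    apply hni
    rw [injective_iff_map_eq_zero]
    intro w hw
    have hw1 : ∀ j, (g' y w) j = 0 := by intro j; rw [hw]; rfl
    have hzi : fderiv ℝ ζ y w = 0 := by simpa [hg'] using hw1 i
    have hwj : ∀ j, j ≠ i → (fderiv ℝ h y w) j = 0 := by
      intro j hj; simpa [hg', hj] using hw1 j
    have hc := hconstr y hy.1 w
    rw [one_mul, hzi, PiLp.inner_apply, ← Finset.add_sum_erase _ _ (Finset.mem_univ i),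
      Finset.sum_eq_zero (fun j hj => by rw [hwj j (Finset.ne_of_mem_erase hj)]; simp)] at hc
    have hyi : h y i ≠ 0 := by
      intro h0
      have := hy.2.2
      simp [h0] at this
    refine himm y hy.1 w ?_ hzi
    ext j
    by_cases hj : j = i
    · subst hj
      simp at hc
      simpa using hc.resolve_right hyi
    · exact hwj j hj
  have himg : volume (g '' N) = 0 := by
    refine measure_mono_null (t := {x | x i = 0}) ?_ ?_
    · rintro _ ⟨y, hy, rfl⟩
      show g y i = 0
      rw [hgi, hy.2.1]
    · have := Measure.addHaar_submodule (volume : Measure (EuclideanSpace ℝ (Fin k)))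
        (LinearMap.ker
          (EuclideanSpace.proj (𝕜 := ℝ) i : EuclideanSpace ℝ (Fin k) →L[ℝ] ℝ).toLinearMap)
        (by
          intro htop
          have : EuclideanSpace.single i (1 : ℝ) ∈ LinearMap.ker
            (EuclideanSpace.proj (𝕜 := ℝ) i : EuclideanSpace ℝ (Fin k) →L[ℝ] ℝ).toLinearMap := by
            rw [htop]; trivial
          simp at this)
      refine measure_mono_null (fun x hx => ?_) this
      simpa using hx
  -- The image of N lies in the hyperplane x_i = 0, so the integral of |det g'| over N is zero. As
  -- the determinant never vanishes on N, N is null.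
  have hint := lintegral_abs_det_fderiv_eq_addHaar_image volume hNm
    (fun y hy => (hgd y (hNU hy)).hasFDerivWithinAt) hginj
  rw [himg] at hint
  rw [setLIntegral_eq_zero_iff' hNm (aemeasurable_ofReal_abs_det_fderivWithin volume hNm
    (fun y hy => (hgd y (hNU hy)).hasFDerivWithinAt))] at hint
  refine measure_mono_null (fun y hy => ?_) (ae_iff.1 hint)
  simpa [hy] using hdet y hy

/-! ### Frames and graph charts. -/

theorem coe_pow_three (c : SignType) : (c : ℝ) ^ 3 = c := by
  cases c <;> norm_num

/-- The last coordinate of the points of the model space at Euclidean distance `r` from the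
axis. -/
def height (c : SignType) (r : ℝ) : ℝ := √(1 - c * r ^ 2)

/-- The domain of the graph charts. -/
def chartDomain (c : SignType) (k : ℕ) : Set (EuclideanSpace ℝ (Fin k)) :=
  {y | 0 < 1 - c * ‖y‖ ^ 2}

/-- The signs of the graph charts: two hemispheres for the sphere, one sheet otherwise. -/
def signs : SignType → Finset ℝ
  | .pos => {1, -1}
  | _ => {1}

theorem sq_eq_one_of_mem_signs {c : SignType} {ε : ℝ} (h : ε ∈ signs c) : ε ^ 2 = 1 := by
  cases c <;> simp [signs] at h
  · rw [h]; norm_num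
  · rw [h]; norm_num
  · rcases h with rfl | rfl <;> norm_num

theorem eq_one_of_mem_signs {c : SignType} {ε : ℝ} (h : ε ∈ signs c) (hc : c ≠ 1) : ε = 1 := by
  cases c
  · simpa [signs] using h
  · simpa [signs] using h
  · exact absurd rfl hc

theorem exists_mem_signs {c : SignType} {x : ℝ} (h0 : x ≠ 0) (h : c ≠ 1 → 0 < x) :
    ∃ ε ∈ signs c, 0 < ε * x := by
  cases c
  · exact ⟨1, by simp [signs], by simpa using h (by decide)⟩
  · exact ⟨1, by simp [signs], by simpa using h (by decide)⟩
  · rcases lt_or_gt_of_ne h0 with h1 | h1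
    · exact ⟨-1, by simp [signs], by linarith⟩
    · exact ⟨1, by simp [signs], by linarith⟩

/-- The Riemannian measure of a totally geodesic submanifold in a graph chart. -/
def flatMeasure (c : SignType) (k : ℕ) : Measure (EuclideanSpace ℝ (Fin k)) :=
  (volume.restrict (chartDomain c k)).withDensity fun y => ENNReal.ofReal (height c ‖y‖)⁻¹

/-- Linear coordinates on a linear subspace of the ambient space in which the model space is the
quadric `c |y|² + ζ² = 1`. -/
structure Frame (c : SignType) (n k : ℕ) where
  /-- The point with given coordinates. -/
  T : EuclideanSpace ℝ (Fin k) × ℝ →L[ℝ] Ambient n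
  /-- The coordinates of a point. -/
  P : Ambient n →L[ℝ] EuclideanSpace ℝ (Fin k) × ℝ
  P_T : ∀ p, P (T p) = p
  mem_iff : ∀ y ζ, T (y, ζ) ∈ modelSet c n ↔ c * ‖y‖ ^ 2 + ζ ^ 2 = 1 ∧ (c ≠ 1 → 0 < ζ)
  -- For c = 0 the ambient form ignores the last coordinate, but T(0, 1) may have a horizontal
  -- component. The formula is therefore required only on tangent vectors, for which ζ-components
  -- vanish.
  form_T : ∀ p p', (c = 0 → p.2 = 0 ∧ p'.2 = 0) →
    form c (T p) (T p') = ⟪p.1, p'.1⟫ + c * (p.2 * p'.2)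

namespace Frame

variable {c : SignType} {n k : ℕ} (F : Frame c n k)

/-- The totally geodesic submanifold spanned by the frame. -/
def carrier : Set (Model c n) := {x | (x : Ambient n) ∈ Set.range F.T}

open scoped Classical in
/-- The graph chart of the totally geodesic submanifold. -/
def chart (ε : ℝ) (y : EuclideanSpace ℝ (Fin k)) : Model c n :=
  if h : F.T (y, ε * height c ‖y‖) ∈ modelSet c n then ⟨_, h⟩ else origin c n

/-- The measure carried by a graph chart. -/
def chartMeasure (ε : ℝ) : Measure (Model c n) := (flatMeasure c k).map (F.chart ε)

theorem mem_modelSet {ε : ℝ} (hε : ε ∈ signs c) {y : EuclideanSpace ℝ (Fin k)}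
    (hy : y ∈ chartDomain c k) : F.T (y, ε * height c ‖y‖) ∈ modelSet c n := by
  rw [F.mem_iff]
  have hy' : 0 < 1 - c * ‖y‖ ^ 2 := hy
  refine ⟨?_, fun hc => ?_⟩
  · rw [mul_pow, sq_eq_one_of_mem_signs hε, height, Real.sq_sqrt hy'.le]
    ring
  · rw [eq_one_of_mem_signs hε hc, one_mul]
    exact Real.sqrt_pos.2 hy'

theorem chart_coe {ε : ℝ} (hε : ε ∈ signs c) {y : EuclideanSpace ℝ (Fin k)}
    (hy : y ∈ chartDomain c k) :
    (F.chart ε y : Ambient n) = F.T (y, ε * height c ‖y‖) := by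
  rw [chart, dif_pos (F.mem_modelSet hε hy)]

theorem height_nonneg (c : SignType) (r : ℝ) : 0 ≤ height c r := Real.sqrt_nonneg _

theorem continuous_height (c : SignType) : Continuous (height c) := by
  unfold height
  fun_prop

theorem isOpen_chartDomain (c : SignType) (k : ℕ) : IsOpen (chartDomain c k) :=
  isOpen_lt continuous_const (by fun_prop)

theorem measurableSet_modelSet (c : SignType) (n : ℕ) : MeasurableSet (modelSet c n) := by
  cases c
  · exact measurableSet_eq_fun (f := fun x : Ambient n => x (Fin.last n)) (by fun_prop)
      measurable_const
  · exact (measurableSet_eq_fun (f := fun x : Ambient n => x (Fin.last n) ^ 2 -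
      ∑ i : Fin n, x i.castSucc ^ 2) (by fun_prop) measurable_const).inter
      (measurableSet_lt (f := fun _ : Ambient n => (0 : ℝ)) measurable_const (by fun_prop))
  · exact measurableSet_eq_fun (f := fun x : Ambient n => (∑ i : Fin n, x i.castSucc ^ 2) +
      x (Fin.last n) ^ 2) (by fun_prop) measurable_const

open scoped Classical in
theorem measurable_chart (ε : ℝ) : Measurable (F.chart ε) := by
  have hc : Continuous fun y : EuclideanSpace ℝ (Fin k) => F.T (y, ε * height c ‖y‖) := by
    exact F.T.continuous.comp (continuous_id.prodMk
      (continuous_const.mul ((continuous_height c).comp continuous_norm)))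
  have hm : Measurable fun y => (F.chart ε y : Ambient n) := by
    have e : (fun y => (F.chart ε y : Ambient n)) = fun y =>
        if F.T (y, ε * height c ‖y‖) ∈ modelSet c n then F.T (y, ε * height c ‖y‖)
        else (origin c n : Ambient n) := by
      ext1 y
      unfold chart
      split_ifs <;> rfl
    rw [e]
    exact Measurable.ite (hc.measurable (measurableSet_modelSet c n)) hc.measurable
      measurable_const
  exact hm.subtype_mk

/-! ### The Riemannian measure of a totally geodesic submanifold in graph charts. -/

/-- The first `k` frame coordinates of a map into the model space. -/
def coord (φ : EuclideanSpace ℝ (Fin k) → Model c n) (y : EuclideanSpace ℝ (Fin k)) :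
    EuclideanSpace ℝ (Fin k) := (F.P (φ y)).1

/-- The last frame coordinate of a map into the model space. -/
def last (φ : EuclideanSpace ℝ (Fin k) → Model c n) (y : EuclideanSpace ℝ (Fin k)) : ℝ :=
  (F.P (φ y)).2

variable {F} {U : Set (EuclideanSpace ℝ (Fin k))} {φ : EuclideanSpace ℝ (Fin k) → Model c n}
  (hφ : IsLocalParam c F.carrier U φ) {y : EuclideanSpace ℝ (Fin k)} (hy : y ∈ U)

theorem T_P {x : Model c n} (hx : x ∈ F.carrier) : F.T (F.P x) = x := by
  obtain ⟨p, hp⟩ := hx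
  rw [← hp, F.P_T]

theorem quadric_of_mem {x : Model c n} (hx : x ∈ F.carrier) :
    c * ‖(F.P x).1‖ ^ 2 + (F.P x).2 ^ 2 = 1 ∧ (c ≠ 1 → 0 < (F.P x).2) := by
  rw [← F.mem_iff, Prod.mk.eta, T_P hx]
  exact x.2

include hφ hy

theorem hasFDerivAt_localParam : HasFDerivAt (fun z => (φ z : Ambient n))
    (fderiv ℝ (fun z => (φ z : Ambient n)) y) y :=
  (((hφ.smooth y hy).contDiffAt (hφ.isOpen.mem_nhds hy)).differentiableAt (by simp)).hasFDerivAt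

theorem hasFDerivAt_coord : HasFDerivAt (F.coord φ)
    (((ContinuousLinearMap.fst ℝ _ ℝ).comp F.P).comp
      (fderiv ℝ (fun z => (φ z : Ambient n)) y)) y :=
  ((ContinuousLinearMap.fst ℝ _ ℝ).comp F.P).hasFDerivAt.comp y (hasFDerivAt_localParam hφ hy)

theorem hasFDerivAt_last : HasFDerivAt (F.last φ)
    (((ContinuousLinearMap.snd ℝ (EuclideanSpace ℝ (Fin k)) ℝ).comp F.P).comp
      (fderiv ℝ (fun z => (φ z : Ambient n)) y)) y :=
  ((ContinuousLinearMap.snd ℝ (EuclideanSpace ℝ (Fin k)) ℝ).comp F.P).hasFDerivAt.comp y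
    (hasFDerivAt_localParam hφ hy)

/-- Near y one has φ = T ∘ P ∘ φ, because φ takes values in the range of T; uniqueness of the
derivative does the rest. -/
theorem fderiv_localParam (w : EuclideanSpace ℝ (Fin k)) :
    fderiv ℝ (fun z => (φ z : Ambient n)) y w =
      F.T (fderiv ℝ (F.coord φ) y w, fderiv ℝ (F.last φ) y w) := by
  have h1 := hasFDerivAt_localParam hφ hy
  have h2 : HasFDerivAt (fun z => (φ z : Ambient n)) ((F.T.comp F.P).comp
      (fderiv ℝ (fun z => (φ z : Ambient n)) y)) y := by
    refine ((F.T.comp F.P).hasFDerivAt.comp y h1).congr_of_eventuallyEq ?_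
    filter_upwards [hφ.isOpen.mem_nhds hy] with z hz
    exact (T_P (hφ.mapsTo hz)).symm
  rw [(hasFDerivAt_coord hφ hy).fderiv, (hasFDerivAt_last hφ hy).fderiv]
  exact congrArg (fun L : EuclideanSpace ℝ (Fin k) →L[ℝ] Ambient n => L w) (h1.unique h2)

theorem sqrt_det_gram (h0 : F.last φ y ≠ 0) :
    √(gram c φ y).det = |(fderiv ℝ (F.coord φ) y).det| / |F.last φ y| := by
  have hU := hφ.isOpen
  have hq : ∀ z ∈ U, c * ‖F.coord φ z‖ ^ 2 + F.last φ z ^ 2 = 1 :=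
    fun z hz => (quadric_of_mem (hφ.mapsTo hz)).1
  have hd := (hasFDerivAt_coord hφ hy).differentiableAt.hasFDerivAt
  have hdζ := (hasFDerivAt_last hφ hy).differentiableAt.hasFDerivAt
  have hconstr := inner_fderiv_of_quadric hU hy hd hdζ hq
  rw [← abs_div, ← Real.sqrt_sq_eq_abs, ← det_gram_of_quadric _ (fderiv ℝ (F.last φ) y)
    (F.coord φ y) (F.last φ y) c (coe_pow_three c) (hq y hy) h0 hconstr]
  congr 2
  unfold gram
  congr 1
  ext i j
  rw [fderiv_localParam hφ hy, fderiv_localParam hφ hy, F.form_T]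
  -- For c = 0 the tangency relation reads ζ dζ = 0, hence dζ = 0, as `form_T` demands.
  rintro rfl
  have h1 : ∀ w, fderiv ℝ (F.last φ) y w = 0 := fun w => by
    have := hconstr w
    simpa [h0] using this
  exact ⟨h1 _, h1 _⟩

-- The quadric equation determines ζ up to sign by y, and the sign is ε; so this part of the
-- parametrisation factors through the chart of sign ε.
omit hy in
theorem coord_mem_chartDomain {y : EuclideanSpace ℝ (Fin k)} (hy : y ∈ U) {ε : ℝ}
    (hε : ε ∈ signs c) (h0 : 0 < ε * F.last φ y) :
    F.coord φ y ∈ chartDomain c k ∧ F.last φ y = ε * height c ‖F.coord φ y‖ ∧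
      φ y = F.chart ε (F.coord φ y) := by
  have hq := (quadric_of_mem (hφ.mapsTo hy)).1
  change c * ‖F.coord φ y‖ ^ 2 + F.last φ y ^ 2 = 1 at hq
  have hl : F.last φ y ≠ 0 := fun h => by simp [h] at h0
  have hm : F.coord φ y ∈ chartDomain c k := by
    show 0 < 1 - c * ‖F.coord φ y‖ ^ 2
    have := sq_pos_of_ne_zero hl
    linarith
  have hε2 := sq_eq_one_of_mem_signs hε
  have he : F.last φ y = ε * height c ‖F.coord φ y‖ := by
    rw [height, show 1 - c * ‖F.coord φ y‖ ^ 2 = (ε * F.last φ y) ^ 2 by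
      rw [mul_pow, hε2]; linarith, Real.sqrt_sq h0.le, ← mul_assoc, ← sq, hε2, one_mul]
  refine ⟨hm, he, Subtype.ext ?_⟩
  rw [F.chart_coe hε hm, ← he]
  exact (T_P (hφ.mapsTo hy)).symm

-- Where εζ > 0, the map to the frame coordinates y is injective and √det g is its Jacobian over
-- |ζ|. The change of variables formula turns the left side into an integral of the chart density
-- over part of the chart domain.
omit hy in
theorem setLIntegral_gram_le {ε : ℝ} (hε : ε ∈ signs c) {A : Set (Model c n)}
    (hA : MeasurableSet A) :
    ∫⁻ y in {y ∈ U | 0 < ε * F.last φ y ∧ φ y ∈ A}, ENNReal.ofReal √(gram c φ y).det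
      ≤ F.chartMeasure ε A := by
  have hU := hφ.isOpen
  have hcφ : ContinuousOn φ U := by
    rw [continuousOn_iff_continuous_domRestrict]
    exact Continuous.subtype_mk
      (continuousOn_iff_continuous_domRestrict.1 hφ.smooth.continuousOn) _
  set S := {y ∈ U | 0 < ε * F.last φ y ∧ φ y ∈ A} with hS
  have hSm : MeasurableSet S := by
    have hcl : ContinuousOn (F.last φ) U := fun y hy =>
      (hasFDerivAt_last hφ hy).continuousAt.continuousWithinAt
    have e : S = (U ∩ (fun y => ε * F.last φ y) ⁻¹' Ioi 0) ∩ (U ∩ φ ⁻¹' A) := by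
      ext y
      simp only [hS, mem_ofPred_eq, mem_inter_iff, mem_preimage, mem_Ioi]
      tauto
    rw [e]
    refine ((continuousOn_const.mul hcl).isOpen_inter_preimage hU isOpen_Ioi).measurableSet.inter ?_
    have e' : U ∩ φ ⁻¹' A = Subtype.val '' ((U.domRestrict φ) ⁻¹' A) := by
      ext y
      simp [and_comm]
    rw [e']
    exact hU.measurableSet.subtype_image
      ((continuousOn_iff_continuous_domRestrict.1 hcφ).measurable hA)
  have hinj : InjOn (F.coord φ) S := by
    intro y hy z hz hyz
    refine hφ.injOn hy.1 hz.1 ?_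
    rw [(coord_mem_chartDomain hφ hy.1 hε hy.2.1).2.2, hyz,
      ← (coord_mem_chartDomain hφ hz.1 hε hz.2.1).2.2]
  have hd : ∀ y ∈ S, HasFDerivWithinAt (F.coord φ) (fderiv ℝ (F.coord φ) y) S y := fun y hy =>
    (hasFDerivAt_coord hφ hy.1).differentiableAt.hasFDerivAt.hasFDerivWithinAt
  have hε1 : |ε| = 1 := by
    rw [← sq_eq_sq₀ (abs_nonneg _) zero_le_one, sq_abs, sq_eq_one_of_mem_signs hε, one_pow]
  calc ∫⁻ y in S, ENNReal.ofReal √(gram c φ y).det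
      = ∫⁻ y in S, ENNReal.ofReal |(fderiv ℝ (F.coord φ) y).det| *
          ENNReal.ofReal (height c ‖F.coord φ y‖)⁻¹ := by
        refine setLIntegral_congr_fun hSm fun y hy => ?_
        obtain ⟨h1, h2, h3⟩ := coord_mem_chartDomain hφ hy.1 hε hy.2.1
        have hl : F.last φ y ≠ 0 := fun h => by simpa [h] using hy.2.1
        rw [sqrt_det_gram hφ hy.1 hl, ← ENNReal.ofReal_mul (abs_nonneg _), div_eq_mul_inv, h2,
          abs_mul, hε1, one_mul, abs_of_nonneg (height_nonneg c _)]
    _ = ∫⁻ x in F.coord φ '' S, ENNReal.ofReal (height c ‖x‖)⁻¹ :=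
        (lintegral_image_eq_lintegral_abs_det_fderiv_mul volume hSm hd hinj
          fun x => ENNReal.ofReal (height c ‖x‖)⁻¹).symm
    _ ≤ ∫⁻ x in F.chart ε ⁻¹' A ∩ chartDomain c k, ENNReal.ofReal (height c ‖x‖)⁻¹ := by
        refine lintegral_mono_set ?_
        rintro _ ⟨y, hy, rfl⟩
        obtain ⟨h1, h2, h3⟩ := coord_mem_chartDomain hφ hy.1 hε hy.2.1
        refine ⟨?_, h1⟩
        rw [mem_preimage, ← h3]
        exact hy.2.2
    _ = F.chartMeasure ε A := by
        rw [chartMeasure, Measure.map_apply (F.measurable_chart ε) hA, flatMeasure,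
          withDensity_apply _ (F.measurable_chart ε hA),
          Measure.restrict_restrict (F.measurable_chart ε hA)]

omit hy in
theorem volume_last_eq_zero : volume {y ∈ U | F.last φ y = 0} = 0 := by
  by_cases hc : c = 1
  · subst hc
    refine volume_equator_eq_zero hφ.isOpen (h := F.coord φ)
      (fun y hy => (hasFDerivAt_coord hφ hy).differentiableAt.differentiableWithinAt)
      (fun y hy => (hasFDerivAt_last hφ hy).differentiableAt.differentiableWithinAt)
      (fun y hy => ?_) (fun y hy z hz hyz => hφ.injOn hy hz (Subtype.ext ?_)) ?_
    · have := (quadric_of_mem (hφ.mapsTo hy)).1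
      rw [SignType.coe_one, one_mul] at this
      exact this
    · rw [← T_P (hφ.mapsTo hy), ← T_P (hφ.mapsTo hz)]
      exact congrArg F.T hyz
    · intro y hy w h1 h2
      refine (injective_iff_map_eq_zero _).1 (hφ.immersion y hy) w ?_
      rw [fderiv_localParam hφ hy, h1, h2]
      exact map_zero F.T
  · convert measure_empty (μ := (volume : Measure (EuclideanSpace ℝ (Fin k))))
    ext y
    simp only [mem_ofPred_eq, mem_empty_iff_false, iff_false, not_and]
    exact fun hy => ((quadric_of_mem (hφ.mapsTo hy)).2 hc).ne'

-- The parametrised piece splits into the sets εζ > 0, controlled by the charts, and the negligible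
-- set ζ = 0. Since `riemannianMeasure` is a supremum over parametrisations, this bounds it from
-- above.
omit hy in
theorem paramMeasure_le : paramMeasure c U φ ≤ ∑ ε ∈ signs c, F.chartMeasure ε := by
  have hU := hφ.isOpen
  have hcφ : ContinuousOn φ U := by
    rw [continuousOn_iff_continuous_domRestrict]
    exact Continuous.subtype_mk
      (continuousOn_iff_continuous_domRestrict.1 hφ.smooth.continuousOn) _
  refine Measure.le_iff.2 fun A hA => ?_
  rw [Measure.finsetSum_apply, paramMeasure, Measure.map_apply_of_aemeasurable _ hA]
  swap
  · exact (hcφ.aemeasurable hU.measurableSet).mono_ac (withDensity_absolutelyContinuous _ _)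
  set g := fun y => ENNReal.ofReal √(gram c φ y).det
  rw [withDensity_apply', Measure.restrict_restrict' hU.measurableSet,
    ← withDensity_apply' (μ := volume) g]
  have hsub : φ ⁻¹' A ∩ U ⊆ {y ∈ U | F.last φ y = 0} ∪
      ⋃ ε ∈ signs c, {y ∈ U | 0 < ε * F.last φ y ∧ φ y ∈ A} := by
    rintro y ⟨hyA, hyU⟩
    by_cases h0 : F.last φ y = 0
    · exact Or.inl ⟨hyU, h0⟩
    · obtain ⟨ε, hε, hpos⟩ := exists_mem_signs h0 (quadric_of_mem (hφ.mapsTo hyU)).2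
      exact Or.inr (mem_biUnion (x := ε) hε ⟨hyU, hpos, hyA⟩)
  have hnull : volume.withDensity g {y ∈ U | F.last φ y = 0} = 0 :=
    withDensity_absolutelyContinuous _ _ (volume_last_eq_zero hφ)
  calc volume.withDensity g (φ ⁻¹' A ∩ U)
      ≤ volume.withDensity g {y ∈ U | F.last φ y = 0} + volume.withDensity g
          (⋃ ε ∈ signs c, {y ∈ U | 0 < ε * F.last φ y ∧ φ y ∈ A}) :=
        (measure_mono hsub).trans (measure_union_le _ _)
    _ ≤ ∑ ε ∈ signs c, volume.withDensity g {y ∈ U | 0 < ε * F.last φ y ∧ φ y ∈ A} := by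
        rw [hnull, zero_add]
        exact measure_biUnion_finset_le _ _
    _ ≤ ∑ ε ∈ signs c, F.chartMeasure ε A := by
        refine Finset.sum_le_sum fun ε hε => ?_
        rw [withDensity_apply']
        exact setLIntegral_gram_le hφ hε hA

omit hφ hy in
/-- The Riemannian measure of a totally geodesic submanifold is carried by its graph charts. -/
theorem riemannianMeasure_carrier_le (F : Frame c n k) :
    riemannianMeasure c k F.carrier ≤ ∑ ε ∈ signs c, F.chartMeasure ε := by
  refine sSup_le ?_
  rintro _ ⟨U, φ, hφ, rfl⟩
  exact paramMeasure_le hφ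

omit hφ hy in
theorem isLocalParam_chart (F : Frame c n k) {ε : ℝ} (hε : ε ∈ signs c) :
    IsLocalParam c F.carrier (chartDomain c k) (F.chart ε) := by
  have hO := isOpen_chartDomain c k
  have hPc : ∀ y ∈ chartDomain c k, F.P (F.chart ε y) = (y, ε * height c ‖y‖) := fun y hy => by
    rw [F.chart_coe hε hy, F.P_T]
  have hs : ContDiffOn ℝ ∞ (fun z => (F.chart ε z : Ambient n)) (chartDomain c k) := by
    refine ContDiffOn.congr (f := fun y => F.T (y, ε * height c ‖y‖)) ?_
      fun y hy => F.chart_coe hε hy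
    refine F.T.contDiff.comp_contDiffOn (contDiffOn_id.prodMk (contDiffOn_const.mul ?_))
    have : ContDiff ℝ ∞ fun y : EuclideanSpace ℝ (Fin k) => 1 - c * ‖y‖ ^ 2 :=
      contDiff_const.sub (contDiff_const.mul (contDiff_norm_sq ℝ))
    exact this.contDiffOn.sqrt fun y hy => ne_of_gt hy
  refine ⟨hO, hs, fun y hy z hz hyz => ?_, fun y hy => ?_, fun y hy => ?_⟩
  · have := (hPc y hy).symm.trans ((congrArg (fun x : Model c n => F.P x) hyz).trans (hPc z hz))
    exact congrArg Prod.fst this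
  · have hd : HasFDerivAt (fun z => (F.chart ε z : Ambient n))
        (fderiv ℝ (fun z => (F.chart ε z : Ambient n)) y) y :=
      (((hs y hy).contDiffAt (hO.mem_nhds hy)).differentiableAt (by simp)).hasFDerivAt
    have h1 := ((ContinuousLinearMap.fst ℝ _ ℝ).comp F.P).hasFDerivAt.comp y hd
    have h2 : HasFDerivAt (((ContinuousLinearMap.fst ℝ _ ℝ).comp F.P) ∘
        fun z => (F.chart ε z : Ambient n))
        (ContinuousLinearMap.id ℝ (EuclideanSpace ℝ (Fin k))) y := by
      refine (hasFDerivAt_id y).congr_of_eventuallyEq ?_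
      filter_upwards [hO.mem_nhds hy] with z hz
      simp [hPc z hz]
    have h3 := h1.unique h2
    intro v w hvw
    have h4 := congrArg ((ContinuousLinearMap.fst ℝ _ ℝ).comp F.P) hvw
    have h5 : ∀ v, ((ContinuousLinearMap.fst ℝ _ ℝ).comp F.P)
        (fderiv ℝ (fun z => (F.chart ε z : Ambient n)) y v) = v := fun v =>
      congrArg (fun L : EuclideanSpace ℝ (Fin k) →L[ℝ] EuclideanSpace ℝ (Fin k) => L v) h3
    rwa [h5, h5] at h4
  · exact ⟨_, (F.chart_coe hε hy).symm⟩

-- The chart is itself one of the parametrisations in the supremum, and its Jacobian in its own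
-- coordinates is 1. Applied to the whole of X, this bounds `vol` from below, which is the direction
-- needed for the Lorentz norm.
omit hφ hy in
theorem chartMeasure_le_riemannianMeasure (F : Frame c n k) {ε : ℝ} (hε : ε ∈ signs c) :
    F.chartMeasure ε ≤ riemannianMeasure c k F.carrier := by
  have hφ := F.isLocalParam_chart hε
  refine le_sSup ⟨chartDomain c k, F.chart ε, hφ, ?_⟩
  rw [chartMeasure, paramMeasure, flatMeasure]
  congr 1
  refine withDensity_congr_ae ?_
  filter_upwards [ae_restrict_mem (isOpen_chartDomain c k).measurableSet] with y hy
  have hPc : ∀ y ∈ chartDomain c k, F.P (F.chart ε y) = (y, ε * height c ‖y‖) := fun y hy => by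
    rw [F.chart_coe hε hy, F.P_T]
  have hl : F.last (F.chart ε) y = ε * height c ‖y‖ := congrArg Prod.snd (hPc y hy)
  have hh : 0 < height c ‖y‖ := Real.sqrt_pos.2 hy
  have hε1 : |ε| = 1 := by
    rw [← sq_eq_sq₀ (abs_nonneg _) zero_le_one, sq_abs, sq_eq_one_of_mem_signs hε, one_pow]
  have hε0 : ε ≠ 0 := fun h => by simp [h] at hε1
  have hd : HasFDerivAt (F.coord (F.chart ε))
      (ContinuousLinearMap.id ℝ (EuclideanSpace ℝ (Fin k))) y := by
    refine (hasFDerivAt_id y).congr_of_eventuallyEq ?_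
    filter_upwards [(isOpen_chartDomain c k).mem_nhds hy] with z hz
    exact congrArg Prod.fst (hPc z hz)
  rw [sqrt_det_gram hφ hy (by rw [hl]; exact mul_ne_zero hε0 hh.ne'), hd.fderiv, hl, abs_mul, hε1,
    one_mul, abs_of_pos hh]
  simp [ContinuousLinearMap.det]

end Frame

/-! ### Polar coordinates. -/

section Polar

variable {E : Type*} [NormedAddCommGroup E] [NormedSpace ℝ E] [MeasurableSpace E] [BorelSpace E]
  [FiniteDimensional ℝ E] [Nontrivial E] (μ : Measure E) [μ.IsAddHaarMeasure]

/-- Integration of radial functions in polar coordinates. -/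
theorem lintegral_fun_norm_addHaar {g : ℝ → ℝ≥0∞} (hg : Measurable g) :
    ∫⁻ x, g ‖x‖ ∂μ = μ.toSphere univ *
      ∫⁻ r in Ioi (0 : ℝ), ENNReal.ofReal (r ^ (Module.finrank ℝ E - 1)) * g r := by
  have hm : MeasurableSet ({(0 : E)}ᶜ) := (measurableSet_singleton _).compl
  calc ∫⁻ x, g ‖x‖ ∂μ = ∫⁻ x : ({(0 : E)}ᶜ : Set E), g ‖x.1‖ ∂(μ.comap (↑)) := by
        rw [lintegral_subtype_comap hm fun x => g ‖x‖, restrict_compl_singleton]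
    _ = ∫⁻ p, g p.2.1 ∂μ.toSphere.prod (.volumeIoiPow (Module.finrank ℝ E - 1)) := by
        simpa using μ.measurePreserving_homeomorphUnitSphereProd.lintegral_comp_emb
          (Homeomorph.measurableEmbedding _) (fun p => g p.2.1)
    _ = _ := by
        rw [lintegral_prod _ (by fun_prop)]
        simp only [lintegral_const]
        rw [mul_comm, Measure.volumeIoiPow, lintegral_withDensity_eq_lintegral_mul _
          (by fun_prop) (by fun_prop)]
        simp only [Pi.mul_apply]
        rw [lintegral_subtype_comap measurableSet_Ioi
          fun r => ENNReal.ofReal (r ^ (Module.finrank ℝ E - 1)) * g r]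

/-- A function on `(0, ∞)` is measurable if the corresponding radial function is. -/
theorem aestronglyMeasurable_of_comp_norm {F : Type*} [TopologicalSpace F]
    [TopologicalSpace.PseudoMetrizableSpace F] {G : ℝ → F}
    (hG : AEStronglyMeasurable (fun x : E => G ‖x‖) μ) :
    AEStronglyMeasurable G (volume.restrict (Ioi (0 : ℝ))) := by
  have hm : MeasurableSet ({(0 : E)}ᶜ) := (measurableSet_singleton _).compl
  have h1 : AEStronglyMeasurable (fun x : ({(0 : E)}ᶜ : Set E) => G ‖x.1‖)
      (μ.comap ((↑) : ({(0 : E)}ᶜ : Set E) → E)) := by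
    refine ((MeasurableEmbedding.subtype_coe hm).aestronglyMeasurable_map_iff
      (g := fun x : E => G ‖x‖)).1 ?_
    rw [map_comap_subtype_coe hm]
    exact hG.restrict
  have h2 : AEStronglyMeasurable (fun p : Metric.sphere (0 : E) 1 × Ioi (0 : ℝ) => G p.2.1)
      (μ.toSphere.prod (.volumeIoiPow (Module.finrank ℝ E - 1))) := by
    rw [← μ.measurePreserving_homeomorphUnitSphereProd.map_eq]
    refine (Homeomorph.measurableEmbedding _).aestronglyMeasurable_map_iff.2 ?_
    refine h1.congr (Filter.Eventually.of_forall fun x => ?_)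
    simp
  have h3 : AEStronglyMeasurable (fun r : Ioi (0 : ℝ) => G r.1)
      (.volumeIoiPow (Module.finrank ℝ E - 1)) :=
    -- Measurability on the product descends to the radial factor because the measure of the sphere
    -- is nonzero.
    AEStronglyMeasurable.of_comp_snd (f := fun r : Ioi (0 : ℝ) => G r.1) h2 μ.toSphere_ne_zero
  rw [← map_comap_subtype_coe measurableSet_Ioi]
  refine (MeasurableEmbedding.subtype_coe measurableSet_Ioi).aestronglyMeasurable_map_iff.2 ?_
  refine AEStronglyMeasurable.mono_ac ?_ h3
  refine withDensity_absolutelyContinuous' (by fun_prop) ?_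
  exact Filter.Eventually.of_forall fun r => by
    have : (0 : ℝ) < r.1 := r.2
    simpa using pow_pos this _

end Polar

/-! ### Radial parts of the Riemannian measures, and planes off the origin. -/

/-- The distances to the axis of the points of the model space off the axis. -/
def radialDomain (c : SignType) : Set ℝ := {r | 0 < r ∧ 0 < 1 - c * r ^ 2}

theorem measurableSet_radialDomain (c : SignType) : MeasurableSet (radialDomain c) :=
  (measurableSet_lt (f := fun _ : ℝ => (0 : ℝ)) (g := fun r => r)
    measurable_const measurable_id).inter
    (measurableSet_lt (f := fun _ : ℝ => (0 : ℝ)) (g := fun r => 1 - c * r ^ 2)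
      measurable_const (by fun_prop))

/-- The density of the radial part of the Riemannian measure. -/
def radialDensity (c : SignType) (k : ℕ) (r : ℝ) : ℝ≥0∞ :=
  ENNReal.ofReal (r ^ (k - 1) * (height c r)⁻¹)

/-- The radial part of the Riemannian measure in dimension `k`, in terms of the distance to
the axis. -/
def radialMeasure (c : SignType) (k : ℕ) : Measure ℝ :=
  (volume.restrict (radialDomain c)).withDensity (radialDensity c k)

/-- The area of the unit sphere of `ℝᵏ`. -/
def sphereArea (k : ℕ) : ℝ≥0∞ := (volume : Measure (EuclideanSpace ℝ (Fin k))).toSphere univ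

theorem measurable_height (c : SignType) : Measurable (height c) :=
  (Frame.continuous_height c).measurable

theorem measurable_radialDensity (c : SignType) (k : ℕ) : Measurable (radialDensity c k) := by
  have := measurable_height c
  unfold radialDensity
  fun_prop

theorem nontrivial_of_pos {k : ℕ} (hk : 0 < k) : Nontrivial (EuclideanSpace ℝ (Fin k)) :=
  Module.nontrivial_of_finrank_pos (R := ℝ) (by simpa using hk)

theorem map_norm_flatMeasure (c : SignType) {k : ℕ} (hk : 0 < k) :
    (flatMeasure c k).map norm = sphereArea k • radialMeasure c k := by
  have := nontrivial_of_pos hk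
  have hh := measurable_height c
  ext A hA
  have hcA : MeasurableSet {r : ℝ | 0 < 1 - (c : ℝ) * r ^ 2 ∧ r ∈ A} :=
    (measurableSet_lt (f := fun _ : ℝ => (0 : ℝ)) (g := fun r => 1 - (c : ℝ) * r ^ 2)
      measurable_const (by fun_prop)).inter hA
  obtain ⟨B, hB⟩ : ∃ B : Set ℝ, B = {r : ℝ | 0 < 1 - (c : ℝ) * r ^ 2 ∧ r ∈ A} := ⟨_, rfl⟩
  have hmB : ∀ r, r ∈ B ↔ 0 < 1 - (c : ℝ) * r ^ 2 ∧ r ∈ A := fun r => by rw [hB]; rfl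
  rw [← hB] at hcA
  set g : ℝ → ℝ≥0∞ := B.indicator fun r => ENNReal.ofReal (height c r)⁻¹ with hg
  have hgm : Measurable g := Measurable.indicator (by fun_prop) hcA
  have hn : MeasurableSet ((norm : EuclideanSpace ℝ (Fin k) → ℝ) ⁻¹' A) := measurable_norm hA
  calc (flatMeasure c k).map norm A = ∫⁻ y : EuclideanSpace ℝ (Fin k), g ‖y‖ := by
        rw [Measure.map_apply measurable_norm hA, flatMeasure, withDensity_apply _ hn,
          Measure.restrict_restrict hn,
          ← lintegral_indicator (hn.inter (Frame.isOpen_chartDomain c k).measurableSet)]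
        refine lintegral_congr fun y => ?_
        by_cases hy : ‖y‖ ∈ B
        · have h1 : y ∈ norm ⁻¹' A ∩ chartDomain c k := ⟨((hmB _).1 hy).2, ((hmB _).1 hy).1⟩
          rw [indicator_of_mem h1, hg, indicator_of_mem hy]
        · have h1 : y ∉ norm ⁻¹' A ∩ chartDomain c k := fun h => hy ((hmB _).2 ⟨h.2, h.1⟩)
          rw [indicator_of_notMem h1, hg, indicator_of_notMem hy]
    _ = sphereArea k * ∫⁻ r in Ioi (0 : ℝ), ENNReal.ofReal (r ^ (k - 1)) * g r := by
        rw [lintegral_fun_norm_addHaar volume hgm, finrank_euclideanSpace_fin]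
        rfl
    _ = (sphereArea k • radialMeasure c k) A := by
        rw [Measure.smul_apply, smul_eq_mul, radialMeasure, withDensity_apply _ hA,
          Measure.restrict_restrict hA, ← lintegral_indicator measurableSet_Ioi,
          ← lintegral_indicator (hA.inter (measurableSet_radialDomain c))]
        congr 1
        refine lintegral_congr fun r => ?_
        by_cases h0 : 0 < r
        · by_cases hr : r ∈ B
          · have h1 : r ∈ A ∩ radialDomain c := ⟨((hmB r).1 hr).2, h0, ((hmB r).1 hr).1⟩
            rw [indicator_of_mem (mem_Ioi.2 h0), indicator_of_mem h1, hg, indicator_of_mem hr,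
              radialDensity, ENNReal.ofReal_mul (pow_nonneg h0.le _)]
          · have h1 : r ∉ A ∩ radialDomain c := fun h => hr ((hmB r).2 ⟨h.2.2, h.1⟩)
            rw [indicator_of_mem (mem_Ioi.2 h0), indicator_of_notMem h1, hg,
              indicator_of_notMem hr, mul_zero]
        · have h1 : r ∉ A ∩ radialDomain c := fun h => h0 h.2.1
          rw [indicator_of_notMem (notMem_Ioi.2 (not_lt.1 h0)), indicator_of_notMem h1]

theorem restrict_radialDomain_absolutelyContinuous (c : SignType) (k : ℕ) :
    volume.restrict (radialDomain c) ≪ radialMeasure c k := by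
  refine withDensity_absolutelyContinuous' (measurable_radialDensity c k).aemeasurable ?_
  filter_upwards [ae_restrict_mem (measurableSet_radialDomain c)] with r hr
  have h1 : 0 < height c r := Real.sqrt_pos.2 hr.2
  have h2 := hr.1
  simp only [radialDensity, ne_eq, ENNReal.ofReal_eq_zero, not_le]
  positivity

theorem radialMeasure_absolutelyContinuous (c : SignType) (k : ℕ) :
    radialMeasure c k ≪ volume.restrict (radialDomain c) :=
  withDensity_absolutelyContinuous _ _

/-- Up to null sets each flat or radial measure is Lebesgue measure on its domain, so measurability
of a radial function in dimension n passes to every dimension k. -/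
theorem aestronglyMeasurable_radial {F : Type*} [TopologicalSpace F]
    [TopologicalSpace.PseudoMetrizableSpace F] [Zero F] {c : SignType} {n : ℕ} (hn : 0 < n)
    {G : ℝ → F} (hG : AEStronglyMeasurable (fun y => G ‖y‖) (flatMeasure c n)) (k : ℕ) :
    AEStronglyMeasurable G (radialMeasure c k) := by
  have := nontrivial_of_pos hn
  have hW := (Frame.isOpen_chartDomain c n).measurableSet
  have h1 : AEStronglyMeasurable (fun y : EuclideanSpace ℝ (Fin n) => G ‖y‖)
      (volume.restrict (chartDomain c n)) := by
    refine hG.mono_ac (withDensity_absolutelyContinuous' ?_ ?_)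
    · have := measurable_height c
      fun_prop
    · filter_upwards [ae_restrict_mem hW] with y hy
      have h1 : 0 < height c ‖y‖ := Real.sqrt_pos.2 hy
      simpa using h1
  have hcm : MeasurableSet {r : ℝ | 0 < 1 - (c : ℝ) * r ^ 2} :=
    measurableSet_lt (f := fun _ : ℝ => (0 : ℝ)) (g := fun r => 1 - (c : ℝ) * r ^ 2)
      measurable_const (by fun_prop)
  have h2 := aestronglyMeasurable_of_comp_norm (volume : Measure (EuclideanSpace ℝ (Fin n)))
    (G := {r : ℝ | 0 < 1 - (c : ℝ) * r ^ 2}.indicator G)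
    ((aestronglyMeasurable_indicator_iff hW).2 h1)
  have h3 := (aestronglyMeasurable_indicator_iff hcm).1 h2
  rw [Measure.restrict_restrict hcm] at h3
  refine AEStronglyMeasurable.mono_ac (radialMeasure_absolutelyContinuous c k) ?_
  refine h3.mono_measure (Measure.restrict_mono (fun r (hr : r ∈ radialDomain c) =>
    (⟨hr.2, hr.1⟩ : r ∈ {r : ℝ | 0 < 1 - (c : ℝ) * r ^ 2} ∩ Ioi 0)) le_rfl)

/-- The distances to the axis of the points of a totally geodesic submanifold are distributed with
at most the density of a submanifold through the origin, up to the factor `q`. -/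
theorem smul_map_radius_le (c : SignType) {k : ℕ} (hk : 2 ≤ k) {a q : ℝ} (hq : 0 < q)
    (haq : q ^ 2 + c * a ^ 2 = 1) :
    ENNReal.ofReal q • (radialMeasure c k).map (fun r => √(a ^ 2 + q ^ 2 * r ^ 2)) ≤
      radialMeasure c k := by
  set τ : ℝ → ℝ := fun r => √(a ^ 2 + q ^ 2 * r ^ 2) with hτ
  have hτm : Measurable τ := by fun_prop
  have hIm := measurableSet_radialDomain c
  have hpos : ∀ r ∈ radialDomain c, 0 < a ^ 2 + q ^ 2 * r ^ 2 := fun r hr => by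
    have := hr.1
    positivity
  have hτpos : ∀ r ∈ radialDomain c, 0 < τ r := fun r hr => Real.sqrt_pos.2 (hpos r hr)
  have hτsq : ∀ r ∈ radialDomain c, τ r ^ 2 = a ^ 2 + q ^ 2 * r ^ 2 := fun r hr =>
    Real.sq_sqrt (hpos r hr).le
  have hone : ∀ r ∈ radialDomain c, 1 - c * τ r ^ 2 = q ^ 2 * (1 - c * r ^ 2) := fun r hr => by
    rw [hτsq r hr]
    linear_combination -haq
  have hmaps : ∀ r ∈ radialDomain c, τ r ∈ radialDomain c := fun r hr =>
    ⟨hτpos r hr, by rw [hone r hr]; exact mul_pos (pow_pos hq 2) hr.2⟩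
  have hheight : ∀ r ∈ radialDomain c, height c (τ r) = q * height c r := fun r hr => by
    rw [height, hone r hr, Real.sqrt_mul (sq_nonneg q), Real.sqrt_sq hq.le, height]
  -- By q² + ca² = 1, τ(r)² - r² = a²(1 - cr²) ≥ 0.
  have hle : ∀ r ∈ radialDomain c, r ≤ τ r := fun r hr => by
    refine Real.le_sqrt_of_sq_le ?_
    have h1 := mul_nonneg (sq_nonneg a) hr.2.le
    have h2 : a ^ 2 + q ^ 2 * r ^ 2 = r ^ 2 + a ^ 2 * (1 - c * r ^ 2) := by
      linear_combination r ^ 2 * haq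
    linarith
  have hderiv : ∀ r ∈ radialDomain c, HasDerivAt τ (q ^ 2 * r / τ r) r := fun r hr => by
    have h1 : HasDerivAt (fun r : ℝ => a ^ 2 + q ^ 2 * r ^ 2) (q ^ 2 * (2 * r)) r := by
      simpa using ((hasDerivAt_pow 2 r).const_mul (q ^ 2)).const_add (a ^ 2)
    convert h1.sqrt (hpos r hr).ne' using 1
    show q ^ 2 * r / √(a ^ 2 + q ^ 2 * r ^ 2) = _
    field_simp
  have hinj : InjOn τ (radialDomain c) := fun r hr t ht hrt => by
    have h1 := hτsq r hr
    rw [hrt, hτsq t ht] at h1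
    have h2 : r ^ 2 = t ^ 2 := by
      have : q ^ 2 * r ^ 2 = q ^ 2 * t ^ 2 := by linarith
      exact mul_left_cancel₀ (pow_pos hq 2).ne' this
    exact (sq_eq_sq₀ hr.1.le ht.1.le).1 h2
  refine Measure.le_iff.2 fun A hA => ?_
  set S := τ ⁻¹' A ∩ radialDomain c with hS
  have hSm : MeasurableSet S := (hτm hA).inter hIm
  calc (ENNReal.ofReal q • (radialMeasure c k).map τ) A
      = ∫⁻ r in S, ENNReal.ofReal q * radialDensity c k r := by
        rw [Measure.smul_apply, smul_eq_mul, Measure.map_apply hτm hA, radialMeasure,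
          withDensity_apply _ (hτm hA), Measure.restrict_restrict (hτm hA),
          lintegral_const_mul _ (measurable_radialDensity c k)]
    _ ≤ ∫⁻ r in S, ENNReal.ofReal |q ^ 2 * r / τ r| * radialDensity c k (τ r) := by
        refine setLIntegral_mono' hSm fun r hr => ?_
        have hr' := hr.2
        have h0 : 0 < r := hr'.1
        have hh : 0 < height c r := Real.sqrt_pos.2 hr'.2
        have ht := hτpos r hr'
        rw [radialDensity, radialDensity, ← ENNReal.ofReal_mul hq.le,
          ← ENNReal.ofReal_mul (abs_nonneg _), hheight r hr', abs_of_pos (by positivity)]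
        refine ENNReal.ofReal_le_ofReal ?_
        -- Since τ' = q²r/τ and the height at τ(r) is q times the height at r, all factors cancel
        -- except r^(k-2) ≤ τ^(k-2). This is where k ≥ 2 enters.
        obtain ⟨m, rfl⟩ : ∃ m, k = m + 2 := ⟨k - 2, by omega⟩
        have h1 : r ^ m ≤ τ r ^ m := pow_le_pow_left₀ h0.le (hle r hr') m
        have e1 : q * (r ^ (m + 2 - 1) * (height c r)⁻¹) = q * r * (height c r)⁻¹ * r ^ m := by
          rw [show m + 2 - 1 = m + 1 by omega]; ring
        have e2 : q ^ 2 * r / τ r * (τ r ^ (m + 2 - 1) * (q * height c r)⁻¹) =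
            q * r * (height c r)⁻¹ * τ r ^ m := by
          rw [show m + 2 - 1 = m + 1 by omega]; field_simp; ring
        rw [e1, e2]
        gcongr
    _ = ∫⁻ t in τ '' S, radialDensity c k t :=
        (lintegral_image_eq_lintegral_abs_deriv_mul hSm
          (fun r hr => (hderiv r hr.2).hasDerivWithinAt) (hinj.mono inter_subset_right) _).symm
    _ ≤ ∫⁻ t in A ∩ radialDomain c, radialDensity c k t := by
        refine lintegral_mono_set ?_
        rintro _ ⟨r, hr, rfl⟩
        exact ⟨hr.1, hmaps r hr.2⟩
    _ = radialMeasure c k A := by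
        rw [radialMeasure, withDensity_apply _ hA, Measure.restrict_restrict hA]

/-! ### Comparison of the radial measures in dimensions k and n. -/

/-- The loss in the growth exponent of balls, due to the exponential growth of hyperbolic space. -/
def loss : SignType → ℕ
  | .neg => 1
  | _ => 0

/-- The singularity at the equator is integrable: on (0, 1), 1 - r² ≥ 1 - r, and (1 - r)^(-1/2) has
an explicit primitive. The bound then uses √(1 - σ) ≥ 1 - σ. -/
theorem lintegral_inv_height_pos_le {ρ : ℝ} (hρ : 0 < ρ) :
    ∫⁻ r in radialDomain 1 ∩ Iic ρ, ENNReal.ofReal (height 1 r)⁻¹ ≤ ENNReal.ofReal (2 * ρ) := by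
  set σ := min ρ 1 with hσ
  have hσ0 : 0 < σ := lt_min hρ one_pos
  have hσ1 : σ ≤ 1 := min_le_right _ _
  have hint : IntervalIntegrable (fun r : ℝ => (1 - r) ^ (-(1 / 2) : ℝ)) volume 0 σ := by
    have h := (intervalIntegral.intervalIntegrable_rpow' (a := 1 - 0) (b := 1 - σ)
      (r := (-(1 / 2) : ℝ)) (by norm_num)).comp_sub_left 1
    simpa using h
  have hval : ∫ r in (0 : ℝ)..σ, (1 - r) ^ (-(1 / 2) : ℝ) = 2 * (1 - √(1 - σ)) := by
    rw [intervalIntegral.integral_comp_sub_left (fun r : ℝ => r ^ (-(1 / 2) : ℝ)) 1,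
      integral_rpow (Or.inl (by norm_num)), Real.sqrt_eq_rpow]
    norm_num
    ring
  calc ∫⁻ r in radialDomain 1 ∩ Iic ρ, ENNReal.ofReal (height 1 r)⁻¹
      ≤ ∫⁻ r in radialDomain 1 ∩ Iic ρ, ENNReal.ofReal ((1 - r) ^ (-(1 / 2) : ℝ)) := by
        refine setLIntegral_mono' ((measurableSet_radialDomain 1).inter measurableSet_Iic)
          fun r hr => ENNReal.ofReal_le_ofReal ?_
        have h0 : 0 < r := hr.1.1
        have h1 : 0 < 1 - r ^ 2 := by simpa using hr.1.2
        have h2 : 0 < 1 - r := by nlinarith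
        rw [Real.rpow_neg h2.le, ← Real.sqrt_eq_rpow, height]
        refine inv_anti₀ (Real.sqrt_pos.2 h2) (Real.sqrt_le_sqrt ?_)
        simp only [SignType.coe_one, one_mul]
        nlinarith
    _ ≤ ∫⁻ r in Ioc 0 σ, ENNReal.ofReal ((1 - r) ^ (-(1 / 2) : ℝ)) := by
        refine lintegral_mono_set fun r hr => ?_
        have h0 : 0 < r := hr.1.1
        have h1 : 0 < 1 - r ^ 2 := by simpa using hr.1.2
        exact ⟨h0, le_min hr.2 (by nlinarith)⟩
    _ = ENNReal.ofReal (2 * (1 - √(1 - σ))) := by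
        rw [← hval, intervalIntegral.integral_of_le hσ0.le, ofReal_integral_eq_lintegral_ofReal]
        · exact hint.1
        · filter_upwards [ae_restrict_mem measurableSet_Ioc] with r hr
          exact Real.rpow_nonneg (by linarith [hr.2]) _
    _ ≤ ENNReal.ofReal (2 * ρ) := by
        refine ENNReal.ofReal_le_ofReal ?_
        have h1 : 1 - σ ≤ √(1 - σ) := Real.le_sqrt_of_sq_le (by nlinarith)
        have h2 : σ ≤ ρ := min_le_left _ _
        linarith

theorem setLIntegral_radialDensity_le {c : SignType} {k : ℕ} {ρ : ℝ} {M : ℝ} (hM : 0 ≤ M)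
    (h : ∀ r ∈ radialDomain c ∩ Iic ρ, r ^ (k - 1) * (height c r)⁻¹ ≤ M) :
    ∫⁻ r in radialDomain c ∩ Iic ρ, radialDensity c k r ≤ ENNReal.ofReal (M * ρ) := by
  calc ∫⁻ r in radialDomain c ∩ Iic ρ, radialDensity c k r
      ≤ ∫⁻ r in radialDomain c ∩ Iic ρ, ENNReal.ofReal M :=
        setLIntegral_mono' ((measurableSet_radialDomain c).inter measurableSet_Iic)
          fun r hr => ENNReal.ofReal_le_ofReal (h r hr)
    _ ≤ ∫⁻ r in Ioc 0 ρ, ENNReal.ofReal M := lintegral_mono_set fun r hr => ⟨hr.1.1, hr.2⟩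
    _ = ENNReal.ofReal (M * ρ) := by
        rw [setLIntegral_const, Real.volume_Ioc, sub_zero, ENNReal.ofReal_mul hM]

/-- The density is at most r^(k-1) for c = 0 and at most r^(k-2) for c = -1, where √(1 + r²) ≥ r;
for c = 1 the factor r^(k-1) is bounded by ρ^(k-1) and the inverse height is integrated. The factor
2 is needed only for the sphere. -/
theorem radialMeasure_Iic_le (c : SignType) {k : ℕ} (hk : 2 ≤ k) {ρ : ℝ} (hρ : 0 < ρ) :
    radialMeasure c k (Iic ρ) ≤ ENNReal.ofReal (2 * ρ ^ (k - loss c)) := by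
  obtain ⟨m, rfl⟩ : ∃ m, k = m + 2 := ⟨k - 2, by omega⟩
  rw [radialMeasure, withDensity_apply _ measurableSet_Iic,
    Measure.restrict_restrict measurableSet_Iic, inter_comm]
  cases c
  · refine (setLIntegral_radialDensity_le (M := ρ ^ (m + 1)) (by positivity) fun r hr => ?_).trans
      (ENNReal.ofReal_le_ofReal ?_)
    · have h0 : 0 < r := hr.1.1
      have h1 : height SignType.zero r = 1 := by simp [height]
      rw [h1, inv_one, mul_one]
      exact pow_le_pow_left₀ h0.le hr.2 _
    · have : 0 < ρ ^ (m + 2) := by positivity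
      rw [← pow_succ]
      show ρ ^ (m + 2) ≤ 2 * ρ ^ (m + 2)
      linarith
  · refine (setLIntegral_radialDensity_le (M := ρ ^ m) (by positivity) fun r hr => ?_).trans
      (ENNReal.ofReal_le_ofReal ?_)
    · have h0 : 0 < r := hr.1.1
      have h1 : r ≤ height SignType.neg r := by
        refine Real.le_sqrt_of_sq_le ?_
        simp
      calc r ^ (m + 2 - 1) * (height SignType.neg r)⁻¹ ≤ r ^ (m + 1) * r⁻¹ := by
            exact mul_le_mul_of_nonneg_left (inv_anti₀ h0 h1) (by positivity)
        _ = r ^ m := by rw [pow_succ]; field_simp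
        _ ≤ ρ ^ m := pow_le_pow_left₀ h0.le hr.2 _
    · have : 0 < ρ ^ (m + 1) := by positivity
      rw [← pow_succ]
      show ρ ^ (m + 1) ≤ 2 * ρ ^ (m + 1)
      linarith
  · calc ∫⁻ r in radialDomain SignType.pos ∩ Iic ρ, radialDensity SignType.pos (m + 2) r
        ≤ ∫⁻ r in radialDomain 1 ∩ Iic ρ,
            ENNReal.ofReal (ρ ^ (m + 1)) * ENNReal.ofReal (height 1 r)⁻¹ := by
          refine setLIntegral_mono' ((measurableSet_radialDomain _).inter measurableSet_Iic)
            fun r hr => ?_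
          have h0 : 0 < r := hr.1.1
          rw [← ENNReal.ofReal_mul (by positivity)]
          refine ENNReal.ofReal_le_ofReal ?_
          exact mul_le_mul_of_nonneg_right (pow_le_pow_left₀ h0.le hr.2 _)
            (inv_nonneg.2 (Frame.height_nonneg _ _))
      _ ≤ ENNReal.ofReal (ρ ^ (m + 1)) * ENNReal.ofReal (2 * ρ) := by
          rw [lintegral_const_mul' _ _ ENNReal.ofReal_ne_top]
          gcongr
          exact lintegral_inv_height_pos_le hρ
      _ = ENNReal.ofReal (2 * ρ ^ (m + 2 - loss SignType.pos)) := by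
          rw [← ENNReal.ofReal_mul (by positivity)]
          congr 1
          show ρ ^ (m + 1) * (2 * ρ) = 2 * ρ ^ (m + 2)
          ring

/-- The height factors cancel in the quotient of the densities, which is r^(k-n) ≤ ρ^(k-n) for r >
ρ. -/
theorem radialMeasure_inter_Ioi_le (c : SignType) {n k : ℕ} (hk : 1 ≤ k) (hkn : k ≤ n) {ρ : ℝ}
    (hρ : 0 < ρ) {A : Set ℝ} (hA : MeasurableSet A) :
    radialMeasure c k (A ∩ Ioi ρ) ≤ ENNReal.ofReal (ρ ^ (n - k))⁻¹ * radialMeasure c n A := by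
  have hm := hA.inter (measurableSet_Ioi (a := ρ))
  rw [radialMeasure, withDensity_apply _ hm, radialMeasure, withDensity_apply _ hA,
    Measure.restrict_restrict hm, Measure.restrict_restrict hA,
    ← lintegral_const_mul _ (measurable_radialDensity c n)]
  calc ∫⁻ r in A ∩ Ioi ρ ∩ radialDomain c, radialDensity c k r
      ≤ ∫⁻ r in A ∩ Ioi ρ ∩ radialDomain c,
          ENNReal.ofReal (ρ ^ (n - k))⁻¹ * radialDensity c n r := by
        refine setLIntegral_mono' (hm.inter (measurableSet_radialDomain c)) fun r hr => ?_
        have h0 : 0 < r := hr.2.1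
        have hρr : ρ ≤ r := (mem_Ioi.1 hr.1.2).le
        have hh := inv_nonneg.2 (Frame.height_nonneg c r)
        rw [radialDensity, radialDensity, ← ENNReal.ofReal_mul (by positivity)]
        refine ENNReal.ofReal_le_ofReal ?_
        have h1 : ρ ^ (n - k) ≤ r ^ (n - k) := pow_le_pow_left₀ hρ.le hρr _
        have h2 : r ^ (n - 1) = r ^ (k - 1) * r ^ (n - k) := by
          rw [← pow_add]; congr 1; omega
        rw [h2, ← mul_assoc]
        refine mul_le_mul_of_nonneg_right ?_ hh
        rw [inv_mul_eq_div, le_div_iff₀ (by positivity)]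
        gcongr
    _ ≤ ∫⁻ r in A ∩ radialDomain c, ENNReal.ofReal (ρ ^ (n - k))⁻¹ * radialDensity c n r :=
        lintegral_mono_set fun r hr => ⟨hr.1.1, hr.2⟩

theorem radialMeasure_le_rpow (c : SignType) {n k : ℕ} (hk : 2 ≤ k) (hkn : k ≤ n) (A : Set ℝ) :
    radialMeasure c k A ≤ 3 * radialMeasure c n A ^ (((k - loss c : ℕ) : ℝ) / (n - loss c : ℕ)) := by
  -- A measurable hull for the n-dimensional measure leaves the right side unchanged and enlarges
  -- the left.
  wlog hA : MeasurableSet A generalizing A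
  · rw [← measure_toMeasurable (μ := radialMeasure c n) A]
    exact (measure_mono (subset_toMeasurable _ _)).trans (this _ (measurableSet_toMeasurable _ _))
  have hl : loss c ≤ 1 := by cases c <;> simp [loss]
  obtain ⟨a, ha⟩ : ∃ a, a = k - loss c := ⟨_, rfl⟩
  obtain ⟨b, hb⟩ : ∃ b, b = n - loss c := ⟨_, rfl⟩
  rw [← ha, ← hb]
  have ha0 : (0 : ℝ) < a := by exact_mod_cast (by omega : 0 < a)
  have hb0 : (0 : ℝ) < b := by exact_mod_cast (by omega : 0 < b)
  have hab : b = a + (n - k) := by omega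
  rcases eq_or_ne (radialMeasure c n A) ⊤ with htop | htop
  · rw [htop, ENNReal.top_rpow_of_pos (div_pos ha0 hb0), ENNReal.mul_top (by norm_num)]
    exact le_top
  rcases eq_or_ne (radialMeasure c n A) 0 with h0 | h0
  · have := ((radialMeasure_absolutelyContinuous c k).trans
      (restrict_radialDomain_absolutelyContinuous c n)) h0
    rw [this]
    exact zero_le
  set M := (radialMeasure c n A).toReal with hM
  have hM0 : 0 < M := ENNReal.toReal_pos h0 htop
  have hMe : radialMeasure c n A = ENNReal.ofReal M := (ENNReal.ofReal_toReal htop).symm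
  -- The radius with ρ^(n-l) = M: both parts of A then scale like ρ^(k-l) = M^((k-l)/(n-l)), with
  -- constants 2 and 1, whence the 3.
  set ρ := M ^ (1 / (b : ℝ)) with hρ
  have hρ0 : 0 < ρ := Real.rpow_pos_of_pos hM0 _
  have hρb : ρ ^ b = M := by
    rw [hρ, ← Real.rpow_natCast, ← Real.rpow_mul hM0.le, one_div, inv_mul_cancel₀ hb0.ne',
      Real.rpow_one]
  have hρa : ρ ^ a = M ^ ((a : ℝ) / b) := by
    rw [hρ, ← Real.rpow_natCast, ← Real.rpow_mul hM0.le]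
    congr 1
    field_simp
  calc radialMeasure c k A ≤ radialMeasure c k (Iic ρ) + radialMeasure c k (A ∩ Ioi ρ) := by
        refine (measure_mono fun r hr => ?_).trans (measure_union_le _ _)
        rcases le_or_gt r ρ with h | h
        · exact Or.inl h
        · exact Or.inr ⟨hr, h⟩
    _ ≤ ENNReal.ofReal (2 * ρ ^ a) + ENNReal.ofReal (ρ ^ (n - k))⁻¹ * ENNReal.ofReal M := by
        rw [← hMe, ha]
        exact add_le_add (radialMeasure_Iic_le c hk hρ0)
          (radialMeasure_inter_Ioi_le c (by omega) hkn hρ0 hA)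
    _ = ENNReal.ofReal (3 * ρ ^ a) := by
        rw [← ENNReal.ofReal_mul (by positivity), ← ENNReal.ofReal_add (by positivity)
          (by positivity), ← hρb, hab, pow_add]
        congr 1
        field_simp
        ring
    _ = 3 * radialMeasure c n A ^ ((a : ℝ) / b) := by
        rw [ENNReal.ofReal_mul (by norm_num), hρa, hMe, ENNReal.ofReal_rpow_of_pos hM0]
        norm_num

theorem one_div_endpoint (c : SignType) {n k : ℕ} (hk : 2 ≤ k) (hkn : k ≤ n) :
    1 / endpoint c n k = ((k - loss c : ℕ) : ℝ) / (n - loss c : ℕ) := by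
  cases c
  · simp [endpoint, loss]
  · simp [endpoint, loss, Nat.cast_sub (show 1 ≤ k by omega), Nat.cast_sub (show 1 ≤ n by omega)]
  · simp [endpoint, loss]

/-- The end-point estimate for functions of the distance to the axis. -/
theorem lintegral_radialMeasure_le (c : SignType) {n k : ℕ} (hk : 2 ≤ k) (hkn : k ≤ n)
    {G : ℝ → ℂ} (hG : AEStronglyMeasurable G (radialMeasure c k)) :
    ∫⁻ r, ‖G r‖ₑ ∂radialMeasure c k ≤
      3 * lorentzNorm (endpoint c n k) (radialMeasure c n) G := by
  -- Layer-cake formula: the L¹ norm is the integral of the measures of the level sets, to which the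
  -- restricted inequality applies one level at a time.
  have h := lintegral_eq_lintegral_meas_lt (radialMeasure c k) (f := fun r => ‖G r‖)
    (Filter.Eventually.of_forall fun r => norm_nonneg _) hG.norm.aemeasurable
  simp only [ofReal_norm] at h
  rw [h, lorentzNorm, ← lintegral_const_mul' _ _ (by norm_num)]
  refine lintegral_mono fun t => ?_
  rw [one_div_endpoint c hk hkn]
  exact radialMeasure_le_rpow c hk hkn _

/-! ### Construction of frames. -/

section LinearAlgebra

variable {n k : ℕ}

/-- The distance to the axis spanned by the origin of the model spaces. -/
def axisDist (x : Ambient n) : ℝ := √(∑ i : Fin n, x i.castSucc ^ 2)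

theorem axisDist_sq (x : Ambient n) : axisDist x ^ 2 = ∑ i : Fin n, x i.castSucc ^ 2 :=
  Real.sq_sqrt (Finset.sum_nonneg fun _ _ => sq_nonneg _)

theorem axisDist_nonneg (x : Ambient n) : 0 ≤ axisDist x := Real.sqrt_nonneg _

theorem norm_sq_eq_axisDist (x : Ambient n) : ‖x‖ ^ 2 = axisDist x ^ 2 + x (Fin.last n) ^ 2 := by
  rw [EuclideanSpace.real_norm_sq_eq, Fin.sum_univ_castSucc, axisDist_sq]

theorem form_eq_inner (c : SignType) (x y : Ambient n) :
    form c x y = ⟪x, y⟫ + (c - 1) * (x (Fin.last n) * y (Fin.last n)) := by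
  rw [form, PiLp.inner_apply, Fin.sum_univ_castSucc]
  simp [mul_comm]
  ring

theorem mem_modelSet_iff (c : SignType) (x : Ambient n) : x ∈ modelSet c n ↔
    c * axisDist x ^ 2 + x (Fin.last n) ^ 2 = 1 ∧ (c ≠ 1 → 0 < x (Fin.last n)) := by
  rw [axisDist_sq]
  cases c
  · show x (Fin.last n) = 1 ↔ _
    have h0 : SignType.zero ≠ 1 := by decide
    have e : ((SignType.zero : SignType) : ℝ) = 0 := rfl
    simp only [h0, ne_eq, not_false_eq_true, true_imp_iff, e, zero_mul, zero_add]
    constructor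
    · rintro h; simp [h]
    · rintro ⟨h1, h2⟩; nlinarith
  · show (x (Fin.last n) ^ 2 - ∑ i : Fin n, x i.castSucc ^ 2 = 1 ∧ 0 < x (Fin.last n)) ↔ _
    have h0 : SignType.neg ≠ 1 := by decide
    have e : ((SignType.neg : SignType) : ℝ) = -1 := rfl
    simp only [h0, ne_eq, not_false_eq_true, true_imp_iff, e]
    refine and_congr_left fun _ => ⟨fun h => ?_, fun h => ?_⟩ <;> linarith
  · show (∑ i : Fin n, x i.castSucc ^ 2) + x (Fin.last n) ^ 2 = 1 ↔ _
    have h0 : SignType.pos = 1 := rfl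
    have e : ((SignType.pos : SignType) : ℝ) = 1 := rfl
    simp only [h0, ne_eq, not_true_eq_false, false_imp_iff, and_true, SignType.coe_one, one_mul]

/-- The linear map with `T (y, ζ) = ∑ yᵢ vᵢ + ζ e`. -/
def frameMap (v : Fin k → Ambient n) (e : Ambient n) :
    EuclideanSpace ℝ (Fin k) × ℝ →L[ℝ] Ambient n :=
  (∑ i, ((EuclideanSpace.proj (𝕜 := ℝ) i).comp
    (ContinuousLinearMap.fst ℝ (EuclideanSpace ℝ (Fin k)) ℝ)).smulRight (v i)) +
    (ContinuousLinearMap.snd ℝ (EuclideanSpace ℝ (Fin k)) ℝ).smulRight e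

/-- The coordinates with respect to an orthogonal system `v₁, …, vₖ, e`. -/
def frameCoord (v : Fin k → Ambient n) (e : Ambient n) :
    Ambient n →L[ℝ] EuclideanSpace ℝ (Fin k) × ℝ :=
  (((EuclideanSpace.equiv (Fin k) ℝ).symm : (Fin k → ℝ) →L[ℝ] EuclideanSpace ℝ (Fin k)).comp
    (ContinuousLinearMap.pi fun i => innerSL ℝ (v i))).prod ((‖e‖ ^ 2)⁻¹ • innerSL ℝ e)

theorem frameMap_apply (v : Fin k → Ambient n) (e : Ambient n)
    (p : EuclideanSpace ℝ (Fin k) × ℝ) : frameMap v e p = ∑ i, p.1 i • v i + p.2 • e := by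
  simp [frameMap]

variable {v : Fin k → Ambient n} {e : Ambient n} (hv : Orthonormal ℝ v) (he : ∀ i, ⟪v i, e⟫ = 0)

include hv he

theorem inner_frameMap (p p' : EuclideanSpace ℝ (Fin k) × ℝ) :
    ⟪frameMap v e p, frameMap v e p'⟫ = ⟪p.1, p'.1⟫ + ‖e‖ ^ 2 * (p.2 * p'.2) := by
  have he' : ∀ i, ⟪e, v i⟫ = 0 := fun i => by rw [real_inner_comm, he]
  rw [frameMap_apply, frameMap_apply, inner_add_left, inner_add_right, inner_add_right,
    hv.inner_sum]
  simp only [sum_inner, inner_sum, inner_smul_left, inner_smul_right, he, he', mul_zero,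
    Finset.sum_const_zero, real_inner_self_eq_norm_sq, PiLp.inner_apply p.1 p'.1]
  simp [mul_comm]
  ring

theorem frameCoord_frameMap (he0 : e ≠ 0) (p : EuclideanSpace ℝ (Fin k) × ℝ) :
    frameCoord v e (frameMap v e p) = p := by
  have he' : ∀ i, ⟪e, v i⟫ = 0 := fun i => by rw [real_inner_comm, he]
  have hn : ‖e‖ ≠ 0 := norm_ne_zero_iff.2 he0
  refine Prod.ext ?_ ?_
  · ext i
    simp [frameCoord, frameMap_apply, inner_add_right, inner_smul_right, he, inner_sum,
      orthonormal_iff_ite.1 hv]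
  · simp [frameCoord, frameMap_apply, inner_add_right, inner_smul_right, he', inner_sum]
    field_simp

theorem range_frameMap {V : Submodule ℝ (Ambient n)} (hV : Module.finrank ℝ V = k + 1)
    (hvV : ∀ i, v i ∈ V) (heV : e ∈ V) (he0 : e ≠ 0) : Set.range (frameMap v e) = V := by
  have hinj : Function.Injective (frameMap v e) :=
    Function.LeftInverse.injective (frameCoord_frameMap hv he he0)
  have hle : LinearMap.range (frameMap v e).toLinearMap ≤ V := by
    rintro _ ⟨p, rfl⟩
    show frameMap v e p ∈ V
    rw [frameMap_apply]
    exact V.add_mem (V.sum_mem fun i _ => V.smul_mem _ (hvV i)) (V.smul_mem _ heV)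
  have heq : LinearMap.range (frameMap v e).toLinearMap = V := by
    refine Submodule.eq_of_le_of_finrank_eq hle ?_
    rw [LinearMap.finrank_range_of_inj hinj, hV]
    simp
  rw [← heq]
  rfl

omit hv he in
theorem last_frameMap (hl : ∀ i, v i (Fin.last n) = 0) (p : EuclideanSpace ℝ (Fin k) × ℝ) :
    frameMap v e p (Fin.last n) = e (Fin.last n) * p.2 := by
  rw [frameMap_apply]
  simp [hl, mul_comm]

theorem axisDist_frameMap (hl : ∀ i, v i (Fin.last n) = 0)
    (p : EuclideanSpace ℝ (Fin k) × ℝ) :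
    axisDist (frameMap v e p) ^ 2 = ‖p.1‖ ^ 2 + axisDist e ^ 2 * p.2 ^ 2 := by
  have h1 := norm_sq_eq_axisDist (frameMap v e p)
  rw [← real_inner_self_eq_norm_sq, inner_frameMap hv he, last_frameMap hl,
    norm_sq_eq_axisDist e, real_inner_self_eq_norm_sq] at h1
  linarith

end LinearAlgebra

variable {n k : ℕ}

/-- A frame of which all but the last vector are orthogonal to the axis. -/
def axialFrame (c : SignType) {v : Fin k → Ambient n} {e : Ambient n} (hv : Orthonormal ℝ v)
    (he : ∀ i, ⟪v i, e⟫ = 0) (hl : ∀ i, v i (Fin.last n) = 0) (hq : 0 < e (Fin.last n))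
    (hmem : e ∈ modelSet c n) : Frame c n k where
  T := frameMap v e
  P := frameCoord v e
  P_T := frameCoord_frameMap hv he fun h => by simp [h] at hq
  mem_iff y ζ := by
    have h := ((mem_modelSet_iff c e).1 hmem).1
    rw [mem_modelSet_iff, last_frameMap hl, axisDist_frameMap hv he hl, mul_pos_iff_of_pos_left hq]
    refine and_congr_left fun _ => ?_
    have e1 : c * (‖y‖ ^ 2 + axisDist e ^ 2 * ζ ^ 2) + (e (Fin.last n) * ζ) ^ 2 =
        c * ‖y‖ ^ 2 + ζ ^ 2 := by linear_combination ζ ^ 2 * h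
    exact e1 ▸ Iff.rfl
  form_T p p' hp := by
    have h := ((mem_modelSet_iff c e).1 hmem).1
    rw [form_eq_inner, inner_frameMap hv he, last_frameMap hl, last_frameMap hl,
      norm_sq_eq_axisDist e]
    by_cases hc : c = 0
    · rw [(hp hc).1]; ring
    · have hc2 : (c : ℝ) ^ 2 = 1 := by
        cases c
        · exact absurd rfl hc
        · norm_num
        · norm_num
      linear_combination (c * (p.2 * p'.2)) * h - (axisDist e ^ 2 * (p.2 * p'.2)) * hc2

/-- A frame of a linear subspace in the case of the sphere. -/
def sphereFrame {v : Fin k → Ambient n} {e : Ambient n} (hv : Orthonormal ℝ v)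
    (he : ∀ i, ⟪v i, e⟫ = 0) (he1 : ‖e‖ = 1) : Frame 1 n k where
  T := frameMap v e
  P := frameCoord v e
  P_T := frameCoord_frameMap hv he fun h => by simp [h] at he1
  mem_iff y ζ := by
    rw [mem_modelSet_iff, SignType.coe_one, one_mul, ← norm_sq_eq_axisDist,
      ← real_inner_self_eq_norm_sq, inner_frameMap hv he, real_inner_self_eq_norm_sq, he1]
    simp [sq]
  form_T p p' _ := by
    rw [form_eq_inner, inner_frameMap hv he, he1]
    simp

theorem exists_sphereFrame {V : Submodule ℝ (Ambient n)} (hV : Module.finrank ℝ V = k + 1) :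
    ∃ F : Frame 1 n k, Set.range F.T = V := by
  set b := (stdOrthonormalBasis ℝ V).reindex (finCongr hV) with hb
  have hon : Orthonormal ℝ fun i => (b i : Ambient n) :=
    b.orthonormal.comp_linearIsometry V.subtypeₗᵢ
  have hv : Orthonormal ℝ fun i : Fin k => (b i.castSucc : Ambient n) :=
    hon.comp _ (Fin.castSucc_injective k)
  have he : ∀ i : Fin k, ⟪(b i.castSucc : Ambient n), (b (Fin.last k) : Ambient n)⟫ = 0 :=
    fun i => hon.2 (Fin.castSucc_ne_last i)
  have he1 : ‖(b (Fin.last k) : Ambient n)‖ = 1 := hon.1 _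
  exact ⟨sphereFrame hv he he1, range_frameMap hv he hV (fun i => (b i.castSucc).2)
    (b (Fin.last k)).2 fun h => by simp [h] at he1⟩

/-- V meets the horizontal hyperplane x_{n+1} = 0 in dimension k, since x has nonzero last
coordinate; an orthonormal basis there gives the y-coordinates. The component of x orthogonal to it,
rescaled onto X, is the point e of ξ nearest to o; a and q are its distance to the axis and its
height. -/
theorem exists_axialFrame {c : SignType} {V : Submodule ℝ (Ambient n)}
    (hV : Module.finrank ℝ V = k + 1) {x : Ambient n} (hxV : x ∈ V) (hx : x ∈ modelSet c n)
    (hx0 : x (Fin.last n) ≠ 0) :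
    ∃ (F : Frame c n k) (a q : ℝ), 0 < q ∧ q ^ 2 + c * a ^ 2 = 1 ∧ Set.range F.T = V ∧
      (∀ p, F.T p (Fin.last n) = q * p.2) ∧
      ∀ p, axisDist (F.T p) ^ 2 = ‖p.1‖ ^ 2 + a ^ 2 * p.2 ^ 2 := by
  set l : V →ₗ[ℝ] ℝ :=
    (EuclideanSpace.proj (𝕜 := ℝ) (Fin.last n) : Ambient n →L[ℝ] ℝ).toLinearMap.domRestrict V
    with hl
  have hsurj : LinearMap.range l = ⊤ := by
    refine LinearMap.range_eq_top.2 (LinearMap.surjective_of_ne_zero fun h => hx0 ?_)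
    exact congrArg (fun f : V →ₗ[ℝ] ℝ => f ⟨x, hxV⟩) h
  have hker : Module.finrank ℝ (LinearMap.ker l) = k := by
    have := LinearMap.finrank_range_add_finrank_ker l
    rw [hsurj, hV, finrank_top, Module.finrank_self] at this
    omega
  set b := (stdOrthonormalBasis ℝ (LinearMap.ker l)).reindex (finCongr hker) with hb
  set v : Fin k → Ambient n := fun i => ((b i : V) : Ambient n) with hvdef
  have hv : Orthonormal ℝ v :=
    (b.orthonormal.comp_linearIsometry (LinearMap.ker l).subtypeₗᵢ).comp_linearIsometry
      V.subtypeₗᵢ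
  have hvl : ∀ i, v i (Fin.last n) = 0 := fun i => (b i).2
  have hvV : ∀ i, v i ∈ V := fun i => (b i : V).2
  set e₀ : Ambient n := x - ∑ i, ⟪v i, x⟫ • v i with he₀
  have he₀V : e₀ ∈ V := V.sub_mem hxV (V.sum_mem fun i _ => V.smul_mem _ (hvV i))
  have he₀v : ∀ i, ⟪v i, e₀⟫ = 0 := fun i => by
    simp [he₀, inner_sub_right, inner_sum, inner_smul_right, orthonormal_iff_ite.1 hv]
  have he₀l : e₀ (Fin.last n) = x (Fin.last n) := by simp [he₀, hvl]
  set y : EuclideanSpace ℝ (Fin k) := WithLp.toLp 2 fun i => ⟪v i, x⟫ with hy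
  have hxe : x = frameMap v e₀ (y, 1) := by
    rw [frameMap_apply, he₀]
    simp [hy]
  have hxm := (mem_modelSet_iff c x).1 hx
  have hxa : axisDist x ^ 2 = ‖y‖ ^ 2 + axisDist e₀ ^ 2 := by
    have := axisDist_frameMap hv he₀v hvl (y, 1)
    rw [← hxe] at this
    simpa using this
  set D := c * axisDist e₀ ^ 2 + e₀ (Fin.last n) ^ 2 with hD
  -- As x lies on X, D = 1 - c|y|², which settles c = 0 and c = -1. For c = 1, D is a sum of squares
  -- with a nonzero term.
  have hD0 : 0 < D := by
    have h1 := hxm.1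
    rw [hxa] at h1
    have h2 : 0 < e₀ (Fin.last n) ^ 2 := by rw [he₀l]; exact sq_pos_of_ne_zero hx0
    have h3 := sq_nonneg ‖y‖
    have h4 := sq_nonneg (axisDist e₀)
    rw [← he₀l] at h1
    rw [hD]
    cases c
    · have e : ((SignType.zero : SignType) : ℝ) = 0 := rfl
      rw [e] at h1 ⊢; linarith
    · have e : ((SignType.neg : SignType) : ℝ) = -1 := rfl
      rw [e] at h1 ⊢; linarith
    · have e : ((SignType.pos : SignType) : ℝ) = 1 := rfl
      rw [e] at h1 ⊢; linarith
  -- The sign of t makes q positive even if x lies in the lower hemisphere.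
  obtain ⟨t, ht2, htq⟩ : ∃ t : ℝ, t ^ 2 = D⁻¹ ∧ 0 < t * e₀ (Fin.last n) := by
    have hs : 0 < √D⁻¹ := Real.sqrt_pos.2 (inv_pos.2 hD0)
    rcases lt_or_gt_of_ne (he₀l ▸ hx0 : e₀ (Fin.last n) ≠ 0) with h | h
    · exact ⟨-√D⁻¹, by rw [neg_sq, Real.sq_sqrt (inv_nonneg.2 hD0.le)], by nlinarith⟩
    · exact ⟨√D⁻¹, Real.sq_sqrt (inv_nonneg.2 hD0.le), mul_pos hs h⟩
  set e := t • e₀ with he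
  have hev : ∀ i, ⟪v i, e⟫ = 0 := fun i => by rw [he, inner_smul_right, he₀v, mul_zero]
  have hel : e (Fin.last n) = t * e₀ (Fin.last n) := by simp [he]
  have hea : axisDist e ^ 2 = t ^ 2 * axisDist e₀ ^ 2 := by
    rw [axisDist_sq, axisDist_sq, Finset.mul_sum]
    exact Finset.sum_congr rfl fun i _ => by simp [he, mul_pow]
  have hq : 0 < e (Fin.last n) := by rw [hel]; exact htq
  have hemem : c * axisDist e ^ 2 + e (Fin.last n) ^ 2 = 1 := by
    rw [hea, hel, mul_pow, ht2]
    have : D⁻¹ * D = 1 := inv_mul_cancel₀ hD0.ne'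
    rw [hD] at this
    rw [← this]
    ring
  refine ⟨axialFrame c hv hev hvl hq ((mem_modelSet_iff c e).2 ⟨hemem, fun _ => hq⟩),
    axisDist e, e (Fin.last n), hq, by linarith, ?_, fun p => last_frameMap hvl p,
    fun p => axisDist_frameMap hv hev hvl p⟩
  exact range_frameMap hv hev hV hvV (V.smul_mem _ he₀V) fun h => by simp [h] at hq

/-! ### Distances to the origin and the weight s_c'(d(o, ξ)). -/

variable {c : SignType}

theorem geodDist_origin_zero (x : Model 0 n) : geodDist 0 (origin 0 n) x = axisDist x.1 := by
  have hx : x.1 (Fin.last n) = 1 := x.2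
  show dist (origin 0 n).1 x.1 = _
  rw [EuclideanSpace.dist_eq, Fin.sum_univ_castSucc, axisDist, hx]
  simp [origin, Fin.castSucc_ne_last, Real.dist_eq]

theorem form_origin (d : SignType) (x : Model c n) :
    form d (origin c n).1 x.1 = d * x.1 (Fin.last n) := by
  simp [form, origin, Fin.castSucc_ne_last]

theorem geodDist_origin_neg (x : Model (-1) n) :
    geodDist (-1) (origin (-1) n) x = Real.arcosh (x.1 (Fin.last n)) := by
  show Real.arcosh (-form (-1) (origin (-1) n).1 x.1) = _
  rw [form_origin]
  simp

theorem geodDist_origin_pos (x : Model 1 n) :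
    geodDist 1 (origin 1 n) x = Real.arccos (x.1 (Fin.last n)) := by
  show Real.arccos (form 1 (origin 1 n).1 x.1) = _
  rw [form_origin]
  simp

/-- Radial functions take the same value at points with the same last coordinate. -/
theorem IsRadial.congr {f : Model c n → ℂ} (hf : IsRadial c f) {x y : Model c n}
    (h : x.1 (Fin.last n) = y.1 (Fin.last n)) (h' : axisDist x.1 = axisDist y.1) : f x = f y := by
  obtain ⟨F, hF⟩ := hf
  rw [hF, hF]
  congr 3
  cases c
  · exact (geodDist_origin_zero x).trans (h'.trans (geodDist_origin_zero y).symm)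
  · exact (geodDist_origin_neg x).trans
      ((congrArg Real.arcosh h).trans (geodDist_origin_neg y).symm)
  · exact (geodDist_origin_pos x).trans
      ((congrArg Real.arccos h).trans (geodDist_origin_pos y).symm)

/-- The point T(0, 1) of ξ has height q. For c = 0, s' = 1 = q; for c = -1, this point gives d ≤
arcosh q and cosh increases on [0, ∞). For c = 1 the cosine decreases, so d must be bounded below:
no point of ξ is higher than q, and d = arccos q. -/
theorem abs_deriv_s_originDist_le (F : Frame c n k) {a q : ℝ} (hq : 0 < q)
    (haq : q ^ 2 + c * a ^ 2 = 1) (hl : ∀ p, F.T p (Fin.last n) = q * p.2) :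
    |deriv (s c) (originDist c F.carrier)| ≤ q := by
  have hmem : F.T (0, 1) ∈ modelSet c n := (F.mem_iff 0 1).2 (by simp)
  set e : Model c n := ⟨F.T (0, 1), hmem⟩ with he
  have heF : e ∈ F.carrier := ⟨_, rfl⟩
  have hel : e.1 (Fin.last n) = q := by rw [he, hl, mul_one]
  cases c
  · have h1 : s SignType.zero = fun t => t := rfl
    have h2 : ((SignType.zero : SignType) : ℝ) = 0 := rfl
    rw [h2] at haq
    have h3 : (1 : ℝ) ≤ q := by nlinarith
    rw [h1, deriv_id'', abs_one]
    exact h3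
  · have h1 : s SignType.neg = Real.sinh := rfl
    have h2 : ((SignType.neg : SignType) : ℝ) = -1 := rfl
    rw [h2] at haq
    have h3 : (1 : ℝ) ≤ q := by nlinarith [sq_nonneg a]
    have hnn : ∀ d ∈ geodDist SignType.neg (origin SignType.neg n) '' F.carrier, 0 ≤ d := by
      rintro _ ⟨x, -, rfl⟩
      rw [show geodDist SignType.neg (origin SignType.neg n) x = _ from geodDist_origin_neg x]
      refine Real.arcosh_nonneg ?_
      have := ((mem_modelSet_iff _ _).1 x.2)
      rw [h2] at this
      nlinarith [this.1, this.2 (by decide), sq_nonneg (axisDist x.1)]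
    have h4 : originDist SignType.neg F.carrier ≤ Real.arcosh q := by
      refine csInf_le ⟨0, hnn⟩ ⟨e, heF, ?_⟩
      rw [← hel]
      exact geodDist_origin_neg e
    have h5 : 0 ≤ originDist SignType.neg F.carrier := Real.sInf_nonneg hnn
    rw [h1, Real.deriv_sinh, abs_of_pos (Real.cosh_pos _), ← Real.cosh_arcosh h3]
    exact Real.cosh_le_cosh.2 (by rwa [abs_of_nonneg h5, abs_of_nonneg (h5.trans h4)])
  · have h1 : s SignType.pos = Real.sin := rfl
    have h2 : ((SignType.pos : SignType) : ℝ) = 1 := rfl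
    rw [h2] at haq
    have h3 : q ≤ 1 := by nlinarith [sq_nonneg a]
    have h4 : originDist SignType.pos F.carrier = Real.arccos q := by
      refine IsLeast.csInf_eq ⟨⟨e, heF, ?_⟩, ?_⟩
      · rw [← hel]
        exact geodDist_origin_pos e
      · rintro _ ⟨x, hx, rfl⟩
        rw [show geodDist SignType.pos (origin SignType.pos n) x = _ from geodDist_origin_pos x]
        refine Real.arccos_le_arccos ?_
        have h5 := (Frame.quadric_of_mem hx).1
        rw [h2] at h5
        have h6 : (F.P x).2 ≤ 1 := by nlinarith [sq_nonneg ‖(F.P x).1‖]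
        rw [← Frame.T_P hx, hl]
        nlinarith
    rw [h1, Real.deriv_sin, h4, Real.cos_arccos (by linarith) h3, abs_of_pos hq]

theorem measurable_axisDist : Measurable (fun x : Model c n => axisDist x.1) := by
  unfold axisDist
  have : Measurable fun x : Ambient n => √(∑ i : Fin n, x i.castSucc ^ 2) := by fun_prop
  exact this.comp measurable_subtype_coe

theorem measurableSet_pos_last (ε : ℝ) :
    MeasurableSet {x : Model c n | 0 < ε * x.1 (Fin.last n)} := by
  have : Measurable fun x : Ambient n => ε * x (Fin.last n) := by fun_prop
  exact (this.comp measurable_subtype_coe) measurableSet_Ioi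

theorem axisDist_sq_eq (x : Model c n) : x.1 (Fin.last n) ^ 2 = 1 - c * axisDist x.1 ^ 2 := by
  have := ((mem_modelSet_iff c x.1).1 x.2).1
  linarith

theorem ae_flatMeasure_mem (c : SignType) (k : ℕ) :
    ∀ᵐ y ∂flatMeasure c k, y ∈ chartDomain c k :=
  (withDensity_absolutelyContinuous _ _).ae_le
    (ae_restrict_mem (Frame.isOpen_chartDomain c k).measurableSet)

theorem sphereArea_ne_top (k : ℕ) : sphereArea k ≠ ⊤ := measure_ne_top _ _

theorem sphereArea_ne_zero {k : ℕ} (hk : 0 < k) : sphereArea k ≠ 0 := by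
  have := nontrivial_of_pos hk
  rw [sphereArea, Ne, Measure.measure_univ_eq_zero]
  exact Measure.toSphere_ne_zero _

/-! ### Distribution of the distance to the axis on ξ. -/

namespace Frame

variable (F : Frame c n k) {ε : ℝ} (hε : ε ∈ signs c)

include hε

/-- Substituting ζ² = 1 - c|y|² into |y|² + a²ζ² and using 1 - ca² = q². -/
theorem axisDist_chart {a q : ℝ} (haq : q ^ 2 + c * a ^ 2 = 1)
    (ha : ∀ p, axisDist (F.T p) ^ 2 = ‖p.1‖ ^ 2 + a ^ 2 * p.2 ^ 2)
    {y : EuclideanSpace ℝ (Fin k)} (hy : y ∈ chartDomain c k) :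
    axisDist (F.chart ε y).1 = √(a ^ 2 + q ^ 2 * ‖y‖ ^ 2) := by
  have hy' : 0 < 1 - c * ‖y‖ ^ 2 := hy
  rw [F.chart_coe hε hy, ← Real.sqrt_sq (axisDist_nonneg _), ha, mul_pow,
    sq_eq_one_of_mem_signs hε, height, Real.sq_sqrt hy'.le]
  congr 1
  linear_combination (- ‖y‖ ^ 2) * haq

/-- Since q > 0, the sign of ζ is the sign of the ambient height. Charts of ξ and of X with the same
ε thus lie on the same sheet or hemisphere, so one profile serves both. -/
theorem pos_last_chart {q : ℝ} (hq : 0 < q) (hl : ∀ p, F.T p (Fin.last n) = q * p.2)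
    {y : EuclideanSpace ℝ (Fin k)} (hy : y ∈ chartDomain c k) :
    0 < ε * (F.chart ε y).1 (Fin.last n) := by
  have hh : 0 < height c ‖y‖ := Real.sqrt_pos.2 hy
  have h2 := sq_eq_one_of_mem_signs hε
  rw [F.chart_coe hε hy, hl, show ε * (q * (ε * height c ‖y‖)) = ε ^ 2 * (q * height c ‖y‖) by ring,
    h2, one_mul]
  exact mul_pos hq hh

theorem smul_map_axisDist_le (hk : 2 ≤ k) {a q : ℝ} (hq : 0 < q) (haq : q ^ 2 + c * a ^ 2 = 1)
    (ha : ∀ p, axisDist (F.T p) ^ 2 = ‖p.1‖ ^ 2 + a ^ 2 * p.2 ^ 2) :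
    ENNReal.ofReal q • (F.chartMeasure ε).map (fun x => axisDist x.1) ≤
      sphereArea k • radialMeasure c k := by
  have hτ : Measurable fun r : ℝ => √(a ^ 2 + q ^ 2 * r ^ 2) := by fun_prop
  have h1 : (F.chartMeasure ε).map (fun x => axisDist x.1) =
      sphereArea k • (radialMeasure c k).map (fun r => √(a ^ 2 + q ^ 2 * r ^ 2)) := by
    rw [chartMeasure, Measure.map_map measurable_axisDist (F.measurable_chart ε),
      ← Measure.map_smul, ← map_norm_flatMeasure c (by omega : 0 < k),
      Measure.map_map hτ measurable_norm]
    refine Measure.map_congr ?_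
    filter_upwards [ae_flatMeasure_mem c k] with y hy
    exact F.axisDist_chart hε haq ha hy
  rw [h1, smul_comm]
  refine Measure.le_iff.2 fun A hA => ?_
  exact mul_le_mul' le_rfl (smul_map_radius_le c hk hq haq A)

end Frame

/-! ### Radial profiles and the estimate in one chart. -/

/-- The value of a radial function at the distance `r` from the axis, on the sheet or hemisphere
given by the sign `ε`. -/
def profile (F : Frame c n n) (f : Model c n → ℂ) (u : EuclideanSpace ℝ (Fin n)) (ε r : ℝ) : ℂ :=
  f (F.chart ε (r • u))

section Profile

variable {F : Frame c n n} (hl : ∀ p, F.T p (Fin.last n) = p.2)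
  (ha : ∀ p, axisDist (F.T p) = ‖p.1‖) {f : Model c n → ℂ} (hf : IsRadial c f)
  {u : EuclideanSpace ℝ (Fin n)} (hu : ‖u‖ = 1) {ε : ℝ} (hε : ε ∈ signs c)

include hl ha hf hu hε

theorem eq_profile {x : Model c n} (hx : 0 < ε * x.1 (Fin.last n)) :
    f x = profile F f u ε (axisDist x.1) := by
  have h1 := axisDist_sq_eq x
  have hx0 : x.1 (Fin.last n) ≠ 0 := fun h => by simp [h] at hx
  have hr : ‖axisDist x.1 • u‖ = axisDist x.1 := by
    rw [norm_smul, hu, mul_one, Real.norm_of_nonneg (axisDist_nonneg _)]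
  have hd : axisDist x.1 • u ∈ chartDomain c n := by
    show 0 < 1 - c * ‖axisDist x.1 • u‖ ^ 2
    rw [hr, ← h1]
    exact sq_pos_of_ne_zero hx0
  have hε2 := sq_eq_one_of_mem_signs hε
  refine hf.congr ?_ ?_
  · rw [F.chart_coe hε hd, hl, hr, height, ← h1, show x.1 (Fin.last n) ^ 2 =
      (ε * x.1 (Fin.last n)) ^ 2 by rw [mul_pow, hε2, one_mul], Real.sqrt_sq hx.le, ← mul_assoc,
      ← sq, hε2, one_mul]
  · rw [F.chart_coe hε hd, ha, hr]

theorem profile_norm_ae_eq :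
    (fun y => f (F.chart ε y)) =ᵐ[flatMeasure c n] fun y => profile F f u ε ‖y‖ := by
  filter_upwards [ae_flatMeasure_mem c n] with y hy
  rw [eq_profile hl ha hf hu hε (F.pos_last_chart hε one_pos (by simpa using hl) hy),
    F.chart_coe hε hy, ha]

theorem aestronglyMeasurable_profile (hn : 0 < n) (hfm : AEStronglyMeasurable f (vol c n))
    (hF : F.chartMeasure ε ≤ vol c n) (k : ℕ) :
    AEStronglyMeasurable (profile F f u ε) (radialMeasure c k) := by
  refine aestronglyMeasurable_radial hn ?_ k
  exact ((hfm.mono_measure hF).comp_measurable (F.measurable_chart ε)).congr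
    (profile_norm_ae_eq hl ha hf hu hε)

/-- A level set of the profile, pulled back by the norm, is a level set of f in one chart of X. Its
measure, `sphereArea n` times the radial measure, is at most the volume of the level set of f in X.
-/
theorem lorentzNorm_profile_le (hn : 0 < n) (hfm : AEStronglyMeasurable f (vol c n))
    (hF : F.chartMeasure ε ≤ vol c n) {p : ℝ} (hp : 0 ≤ 1 / p) :
    lorentzNorm p (radialMeasure c n) (profile F f u ε) ≤
      (sphereArea n)⁻¹ ^ (1 / p) * lorentzNorm p (vol c n) f := by
  have hG := aestronglyMeasurable_profile hl ha hf hu hε hn hfm hF n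
  have hs := ENNReal.inv_ne_top.2 (sphereArea_ne_zero hn)
  rw [lorentzNorm, lorentzNorm, ← lintegral_const_mul' _ _ (ENNReal.rpow_ne_top_of_nonneg hp hs)]
  refine lintegral_mono fun t => ?_
  rw [← ENNReal.mul_rpow_of_nonneg _ _ hp]
  refine ENNReal.rpow_le_rpow ?_ hp
  set S := {r | t < ‖profile F f u ε r‖} with hS
  have hSm : NullMeasurableSet S (radialMeasure c n) :=
    nullMeasurableSet_lt aemeasurable_const hG.norm.aemeasurable
  have h1 : sphereArea n * radialMeasure c n S ≤ vol c n {x | t < ‖f x‖} := by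
    calc sphereArea n * radialMeasure c n S = (flatMeasure c n).map norm S := by
          rw [map_norm_flatMeasure c hn, Measure.smul_apply, smul_eq_mul]
      _ = flatMeasure c n (norm ⁻¹' S) := by
          refine Measure.map_apply₀ measurable_norm.aemeasurable ?_
          rw [map_norm_flatMeasure c hn]
          exact hSm.mono_ac Measure.smul_absolutelyContinuous
      _ = flatMeasure c n (F.chart ε ⁻¹' {x | t < ‖f x‖}) := by
          refine measure_congr ?_
          filter_upwards [profile_norm_ae_eq hl ha hf hu hε] with y hy
          refine propext ?_
          show t < ‖profile F f u ε ‖y‖‖ ↔ t < ‖f (F.chart ε y)‖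
          rw [hy]
      _ ≤ F.chartMeasure ε {x | t < ‖f x‖} :=
          Measure.le_map_apply (F.measurable_chart ε).aemeasurable _
      _ ≤ vol c n {x | t < ‖f x‖} := hF _
  rw [mul_comm, ← div_eq_mul_inv]
  refine ENNReal.le_div_iff_mul_le (Or.inl (sphereArea_ne_zero hn))
    (Or.inl (sphereArea_ne_top n)) |>.2 ?_
  rwa [mul_comm]

variable {H : Frame c n k} {a q : ℝ} (hq : 0 < q) (haq : q ^ 2 + c * a ^ 2 = 1)
  (hHl : ∀ p, H.T p (Fin.last n) = q * p.2)
  (hHa : ∀ p, axisDist (H.T p) ^ 2 = ‖p.1‖ ^ 2 + a ^ 2 * p.2 ^ 2)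

include hq haq hHl hHa

theorem chartMeasure_estimate (hk : 2 ≤ k) (hkn : k ≤ n) (hfm : AEStronglyMeasurable f (vol c n))
    (hF : F.chartMeasure ε ≤ vol c n) :
    AEStronglyMeasurable f (H.chartMeasure ε) ∧
      ENNReal.ofReal q * ∫⁻ x, ‖f x‖ₑ ∂H.chartMeasure ε ≤
        sphereArea k * (3 * ((sphereArea n)⁻¹ ^ (1 / endpoint c n k) *
          lorentzNorm (endpoint c n k) (vol c n) f)) := by
  have hn : 0 < n := by omega
  have hG := aestronglyMeasurable_profile hl ha hf hu hε hn hfm hF k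
  have hle := H.smul_map_axisDist_le hε hk hq haq hHa
  have hae : (fun x => profile F f u ε (axisDist x.1)) =ᵐ[H.chartMeasure ε] f := by
    have h1 : ∀ᵐ x ∂H.chartMeasure ε, 0 < ε * x.1 (Fin.last n) := by
      refine (ae_map_iff (H.measurable_chart ε).aemeasurable (measurableSet_pos_last ε)).2 ?_
      filter_upwards [ae_flatMeasure_mem c k] with y hy using H.pos_last_chart hε hq hHl hy
    filter_upwards [h1] with x hx
    exact (eq_profile hl ha hf hu hε hx).symm
  have hq0 : ENNReal.ofReal q ≠ 0 := by simpa using hq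
  -- Measurability of f for the measure of ξ, a null set of X, comes from that of its profile; q ≠ 0
  -- allows the factor q to be dropped.
  have hac : (H.chartMeasure ε).map (fun x => axisDist x.1) ≪ radialMeasure c k := by
    refine (Measure.absolutelyContinuous_smul hq0).trans ?_
    exact (Measure.absolutelyContinuous_of_le hle).trans Measure.smul_absolutelyContinuous
  have hG' := hG.mono_ac hac
  refine ⟨(hG'.comp_measurable measurable_axisDist).congr hae, ?_⟩
  calc ENNReal.ofReal q * ∫⁻ x, ‖f x‖ₑ ∂H.chartMeasure ε
      = ENNReal.ofReal q * ∫⁻ x, ‖profile F f u ε (axisDist x.1)‖ₑ ∂H.chartMeasure ε := by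
        congr 1
        refine lintegral_congr_ae ?_
        filter_upwards [hae] with x hx
        rw [hx]
    _ = ∫⁻ r, ‖profile F f u ε r‖ₑ ∂(ENNReal.ofReal q •
          (H.chartMeasure ε).map (fun x => axisDist x.1)) := by
        rw [lintegral_smul_measure, lintegral_map' hG'.enorm measurable_axisDist.aemeasurable,
          smul_eq_mul]
    _ ≤ ∫⁻ r, ‖profile F f u ε r‖ₑ ∂(sphereArea k • radialMeasure c k) :=
        lintegral_mono' hle le_rfl
    _ ≤ _ := by
        rw [lintegral_smul_measure, smul_eq_mul]
        gcongr
        refine (lintegral_radialMeasure_le c hk hkn hG).trans ?_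
        gcongr
        refine lorentzNorm_profile_le hl ha hf hu hε hn hfm hF ?_
        rw [one_div_endpoint c hk hkn]
        positivity

end Profile

/-! ### Assembly: axial planes, equatorial great spheres, the theorem. -/

theorem aestronglyMeasurable_finsetSum {X β ι : Type*} [MeasurableSpace X] [TopologicalSpace β]
    [TopologicalSpace.PseudoMetrizableSpace β] {I : Finset ι} {μ : ι → Measure X} {f : X → β}
    (h : ∀ i ∈ I, AEStronglyMeasurable f (μ i)) : AEStronglyMeasurable f (∑ i ∈ I, μ i) := by
  classical
  induction I using Finset.induction_on with
  | empty => simp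
  | insert i I hi ih =>
    rw [Finset.sum_insert hi]
    exact (h i (Finset.mem_insert_self i I)).add_measure
      (ih fun j hj => h j (Finset.mem_insert_of_mem hj))

/-- The model space as a totally geodesic submanifold of itself. -/
theorem exists_fullFrame (c : SignType) (n : ℕ) : ∃ F : Frame c n n,
    F.carrier = univ ∧ (∀ p, F.T p (Fin.last n) = p.2) ∧ ∀ p, axisDist (F.T p) = ‖p.1‖ := by
  set o : Ambient n := (origin c n).1 with ho
  have hol : o (Fin.last n) = 1 := by simp [ho, origin]
  have hoa : axisDist o ^ 2 = 0 := by
    rw [axisDist_sq]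
    simp [ho, origin, Fin.castSucc_ne_last]
  obtain ⟨F, a, q, hq, haq, hV, hl, ha⟩ := exists_axialFrame (k := n) (V := ⊤) (c := c)
    (by simp) (x := o) trivial (origin c n).2 (by simp [hol])
  obtain ⟨p, hp⟩ : o ∈ Set.range F.T := by rw [hV]; trivial
  have h1 := hl p
  have h2 := ha p
  rw [hp] at h1 h2
  rw [hol] at h1
  rw [hoa] at h2
  have hp2 : p.2 ≠ 0 := fun h => by simp [h] at h1
  have ha0 : a ^ 2 = 0 := by
    have h3 : a ^ 2 * p.2 ^ 2 = 0 := by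
      nlinarith [sq_nonneg ‖p.1‖, mul_nonneg (sq_nonneg a) (sq_nonneg p.2)]
    exact (mul_eq_zero.1 h3).resolve_right (pow_ne_zero 2 hp2)
  have hq1 : q = 1 := by
    rw [ha0, mul_zero, add_zero] at haq
    exact (sq_eq_sq₀ hq.le zero_le_one).1 (by rw [haq, one_pow])
  refine ⟨F, ?_, fun p => by rw [hl, hq1, one_mul], fun p => ?_⟩
  · rw [Frame.carrier, hV]
    exact eq_univ_of_forall fun x => trivial
  · rw [← sq_eq_sq₀ (axisDist_nonneg _) (norm_nonneg _), ha, ha0, zero_mul, add_zero]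

theorem card_signs_le (c : SignType) : (signs c).card ≤ 2 := by
  cases c
  · simp [signs]
  · simp [signs]
  · exact Finset.card_le_two

/-- The constant of the end-point estimate. -/
def endpointConst (n k : ℕ) (c : SignType) : ℝ≥0∞ :=
  -- The 2 bounds the number of charts, the 3 comes from `radialMeasure_le_rpow`, and the sphere
  -- areas convert radial measures into Riemannian ones in dimensions k and n.
  2 * (sphereArea k * (3 * (sphereArea n)⁻¹ ^ (1 / endpoint c n k)))

theorem endpointConst_ne_top (hk : 2 ≤ k) (hkn : k ≤ n) (c : SignType) :
    endpointConst n k c ≠ ⊤ := by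
  refine ENNReal.mul_ne_top (by norm_num) (ENNReal.mul_ne_top (sphereArea_ne_top k)
    (ENNReal.mul_ne_top (by norm_num) (ENNReal.rpow_ne_top_of_nonneg ?_
      (ENNReal.inv_ne_top.2 (sphereArea_ne_zero (by omega))))))
  rw [one_div_endpoint c hk hkn]
  positivity

/-- The end-point estimate on a totally geodesic submanifold that is not contained in the
equator. -/
theorem axial_estimate (hk : 2 ≤ k) (hkn : k ≤ n) {f : Model c n → ℂ} (hf : IsRadial c f)
    (hfm : AEStronglyMeasurable f (vol c n)) (H : Frame c n k) {a q : ℝ} (hq : 0 < q)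
    (haq : q ^ 2 + c * a ^ 2 = 1) (hHl : ∀ p, H.T p (Fin.last n) = q * p.2)
    (hHa : ∀ p, axisDist (H.T p) ^ 2 = ‖p.1‖ ^ 2 + a ^ 2 * p.2 ^ 2) :
    AEStronglyMeasurable f (riemannianMeasure c k H.carrier) ∧
      ENNReal.ofReal q * ∫⁻ x, ‖f x‖ₑ ∂riemannianMeasure c k H.carrier ≤
        endpointConst n k c * lorentzNorm (endpoint c n k) (vol c n) f := by
  obtain ⟨F, hFc, hl, ha⟩ := exists_fullFrame c n
  have hn : 0 < n := by omega
  have hu : ‖(EuclideanSpace.single ⟨0, hn⟩ (1 : ℝ) : EuclideanSpace ℝ (Fin n))‖ = 1 := by simp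
  have hF : ∀ ε ∈ signs c, F.chartMeasure ε ≤ vol c n := fun ε hε => by
    have := F.chartMeasure_le_riemannianMeasure hε
    rwa [hFc] at this
  have hest := fun ε (hε : ε ∈ signs c) =>
    chartMeasure_estimate hl ha hf hu hε hq haq hHl hHa hk hkn hfm (hF ε hε)
  have hle := Frame.riemannianMeasure_carrier_le H
  refine ⟨(aestronglyMeasurable_finsetSum fun ε hε => (hest ε hε).1).mono_measure hle, ?_⟩
  set B := sphereArea k * (3 * ((sphereArea n)⁻¹ ^ (1 / endpoint c n k) *
          lorentzNorm (endpoint c n k) (vol c n) f)) with hB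
  calc ENNReal.ofReal q * ∫⁻ x, ‖f x‖ₑ ∂riemannianMeasure c k H.carrier
      ≤ ENNReal.ofReal q * ∫⁻ x, ‖f x‖ₑ ∂(∑ ε ∈ signs c, H.chartMeasure ε) := by
        gcongr
    _ = ∑ ε ∈ signs c, ENNReal.ofReal q * ∫⁻ x, ‖f x‖ₑ ∂H.chartMeasure ε := by
        rw [lintegral_finsetSum_measure, Finset.mul_sum]
    _ ≤ ∑ ε ∈ signs c, B := Finset.sum_le_sum fun ε hε => (hest ε hε).2
    _ ≤ 2 * B := by
        rw [Finset.sum_const, nsmul_eq_mul]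
        gcongr
        exact_mod_cast card_signs_le c
    _ = _ := by
        rw [hB, endpointConst]
        ring

theorem Frame.ae_mem_carrier (F : Frame c n k) :
    ∀ᵐ x ∂riemannianMeasure c k F.carrier, x ∈ F.carrier := by
  have hm : MeasurableSet F.carrier := by
    have h1 : IsClosed (Set.range F.T) :=
      (LinearMap.range F.T.toLinearMap).closed_of_finiteDimensional
    exact measurable_subtype_coe h1.measurableSet
  have hac := Measure.absolutelyContinuous_of_le (riemannianMeasure_carrier_le F)
  refine hac.ae_le ?_
  rw [mem_ae_iff, Measure.finsetSum_apply, Finset.sum_eq_zero]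
  intro ε hε
  change ∀ᵐ x ∂F.chartMeasure ε, x ∈ F.carrier
  refine (ae_map_iff (F.measurable_chart ε).aemeasurable hm).2 ?_
  filter_upwards [ae_flatMeasure_mem c k] with y hy
  exact ⟨_, (F.chart_coe hε hy).symm⟩

/-- Great spheres have finite measure. -/
theorem Frame.riemannianMeasure_sphere_lt_top (hk : 2 ≤ k) (F : Frame 1 n k) :
    riemannianMeasure 1 k F.carrier univ < ⊤ := by
  refine (riemannianMeasure_carrier_le F univ).trans_lt ?_
  rw [Measure.finsetSum_apply, ENNReal.sum_lt_top]
  intro ε hε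
  have h1 : F.chartMeasure ε univ = (flatMeasure 1 k).map norm univ := by
    rw [chartMeasure, Measure.map_apply (F.measurable_chart ε) MeasurableSet.univ,
      Measure.map_apply measurable_norm MeasurableSet.univ, preimage_univ, preimage_univ]
  have h2 : radialMeasure 1 k univ ≤ radialMeasure 1 k (Iic 1) := by
    refine measure_mono_ae ?_
    have h3 : ∀ᵐ r ∂radialMeasure 1 k, r ∈ radialDomain 1 :=
      (radialMeasure_absolutelyContinuous 1 k).ae_le
        (ae_restrict_mem (measurableSet_radialDomain 1))
    filter_upwards [h3] with r hr _
    have h4 := hr.2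
    have h5 := hr.1
    rw [SignType.coe_one, one_mul] at h4
    show r ≤ 1
    nlinarith
  rw [h1, map_norm_flatMeasure 1 (by omega), Measure.smul_apply, smul_eq_mul]
  refine ENNReal.mul_lt_top (sphereArea_ne_top k).lt_top ?_
  exact (h2.trans (radialMeasure_Iic_le 1 hk one_pos)).trans_lt ENNReal.ofReal_lt_top

/-- All points of the equator are at the same distance from o, so f is constant on this great
sphere, which has finite measure. -/
theorem equatorial_integrable (hk : 2 ≤ k) (F : Frame 1 n k) {f : Model 1 n → ℂ}
    (hf : IsRadial 1 f) (h0 : ∀ x ∈ F.carrier, x.1 (Fin.last n) = 0) :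
    Integrable f (riemannianMeasure 1 k F.carrier) := by
  have : IsFiniteMeasure (riemannianMeasure 1 k F.carrier) :=
    ⟨F.riemannianMeasure_sphere_lt_top hk⟩
  have hmem : F.T (0, 1) ∈ modelSet 1 n := (F.mem_iff 0 1).2 (by simp)
  set e : Model 1 n := ⟨F.T (0, 1), hmem⟩ with he
  have heF : e ∈ F.carrier := ⟨_, rfl⟩
  refine (integrable_const (f e)).congr ?_
  filter_upwards [F.ae_mem_carrier] with x hx
  have ha : ∀ x ∈ F.carrier, axisDist x.1 = 1 := fun x hx => by
    have h1 := axisDist_sq_eq x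
    rw [h0 x hx, SignType.coe_one, one_mul] at h1
    rw [← sq_eq_sq₀ (axisDist_nonneg _) zero_le_one]
    linarith
  exact hf.congr (by rw [h0 x hx, h0 e heF]) (by rw [ha x hx, ha e heF])

/-- Every point of ξ is at distance π/2 from o, and cos(π/2) = 0. -/
theorem deriv_s_originDist_equatorial {ξ : Set (Model 1 n)} (hξ : ξ.Nonempty)
    (h0 : ∀ x ∈ ξ, x.1 (Fin.last n) = 0) : deriv (s 1) (originDist 1 ξ) = 0 := by
  have h1 : geodDist 1 (origin 1 n) '' ξ = {Real.pi / 2} := by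
    refine (hξ.image _).subset_singleton_iff.1 ?_
    rintro _ ⟨x, hx, rfl⟩
    rw [geodDist_origin_pos, h0 x hx, Real.arccos_zero]
    rfl
  rw [originDist, h1, csInf_singleton]
  show deriv Real.sin _ = 0
  rw [Real.deriv_sin, Real.cos_pi_div_two]

theorem endpoint_estimate (hk : 2 ≤ k) (hkn : k ≤ n) {f : Model c n → ℂ} (hf : IsRadial c f)
    (hfm : MemLorentz (endpoint c n k) (vol c n) f) {ξ : Set (Model c n)}
    (hξ : ξ ∈ totallyGeodesic c n k) :
    Integrable f (riemannianMeasure c k ξ) ∧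
      ‖deriv (s c) (originDist c ξ) • kPlaneTransform c k f ξ‖ₑ ≤
        endpointConst n k c * lorentzNorm (endpoint c n k) (vol c n) f := by
  obtain ⟨hne, V, hV, hξV⟩ := hξ
  by_cases h0 : ∀ x ∈ ξ, x.1 (Fin.last n) = 0
  · obtain rfl : c = 1 := by
      by_contra hc
      obtain ⟨x, hx⟩ := hne
      exact (((mem_modelSet_iff c x.1).1 x.2).2 hc).ne' (h0 x hx)
    obtain ⟨F, hF⟩ := exists_sphereFrame hV
    have hξF : ξ = F.carrier := by rw [hξV, Frame.carrier, hF]; rfl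
    refine ⟨?_, ?_⟩
    · rw [hξF] at h0 ⊢
      exact equatorial_integrable hk F hf h0
    · rw [deriv_s_originDist_equatorial hne h0, zero_smul, enorm_zero]
      exact zero_le
  · push Not at h0
    obtain ⟨x, hx, hx0⟩ := h0
    have hxV : x.1 ∈ V := by rw [hξV] at hx; exact hx
    obtain ⟨H, a, q, hq, haq, hH, hHl, hHa⟩ := exists_axialFrame hV hxV x.2 hx0
    have hξH : ξ = H.carrier := by rw [hξV, Frame.carrier, hH]; rfl
    obtain ⟨h1, h2⟩ := axial_estimate hk hkn hf hfm.1 H hq haq hHl hHa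
    rw [hξH]
    refine ⟨⟨h1, ?_⟩, ?_⟩
    · have h3 : ENNReal.ofReal q * ∫⁻ x, ‖f x‖ₑ ∂riemannianMeasure c k H.carrier < ⊤ :=
        h2.trans_lt (ENNReal.mul_lt_top (endpointConst_ne_top hk hkn c).lt_top hfm.2)
      exact ENNReal.lt_top_of_mul_ne_top_right h3.ne (by simpa using hq)
    · rw [enorm_smul]
      refine le_trans ?_ h2
      refine mul_le_mul' ?_ (enorm_integral_le_lintegral_enorm f)
      rw [Real.enorm_eq_ofReal_abs]
      exact ENNReal.ofReal_le_ofReal (abs_deriv_s_originDist_le H hq haq hHl)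

end ConstantCurvature

end

theorem mainTheorem1 (n k : ℕ) (hk : 2 ≤ k) (hkn : k ≤ n - 1) :
    ∃ K : ℝ≥0, ∀ (c : SignType) (f : Model c n → ℂ),
      IsRadial c f → MemLorentz (endpoint c n k) (vol c n) f →
        (∀ ξ ∈ totallyGeodesic c n k, Integrable f (riemannianMeasure c k ξ)) ∧
        (⨆ ξ ∈ totallyGeodesic c n k,
            ‖deriv (s c) (originDist c ξ) • kPlaneTransform c k f ξ‖ₑ)
          ≤ K * lorentzNorm (endpoint c n k) (vol c n) f := by
  have hkn' : k ≤ n := by omega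
  -- Summing the finite constants over the three curvatures makes K independent of c.
  refine ⟨∑ c, (endpointConst n k c).toNNReal, fun c f hf hfm =>
    ⟨fun ξ hξ => (endpoint_estimate hk hkn' hf hfm hξ).1, iSup₂_le fun ξ hξ =>
      (endpoint_estimate hk hkn' hf hfm hξ).2.trans ?_⟩⟩
  gcongr
  rw [← ENNReal.coe_toNNReal (endpointConst_ne_top hk hkn' c)]
  exact_mod_cast Finset.single_le_sum (f := fun c => (endpointConst n k c).toNNReal)
    (fun _ _ => zero_le) (Finset.mem_univ c)
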